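/- Let $K$ be a field, $V$ a $K$-vector space with basis $e_1,\dots,e_n$ and $E=K\langle e_1,\dots,e_n\rangle$ its exterior algebra. For $\mu=\{i_1<\dots<i_d\}\subseteq\{1,\dots,n\}$ let $e_\mu=e_{i_1}\wedge\dots\wedge e_{i_d}$ be the corresponding monomial, of degree $d$. Let $I\subsetneq E$ be a monomial ideal, i.e. an ideal generated by monomials, and let $G(I)$ be its minimal set of monomial generators. Suppose that $I$ has linear quotients with respect to an ordering $u_1,\dots,u_r$ of $G(I)$, that is, for each $k=1,\dots,r$ the ideal $(u_1,\dots,u_{k-1}):(u_k)$ (which is $0:(u_1)$ for $k=1$) is generated by a subset of $\{e_1,\dots,e_n\}$; put $$\mathrm{set}(u_k)=\{s\in\{1,\dots,n\} : e_s\in(u_1,\dots,u_{k-1}):(u_k)\}.$$ Let $G(I)_j$ be the set of $u\in G(I)$ of degree $j$. Then $I$ has a minimal graded free resolution $\cdots\to F_1\to F_0\to I\to 0$ over $E$ with all $F_i$ of finite rank, and the graded Betti numbers $\beta_{i,j}(I)$, defined by $F_i\cong\bigoplus_j E(-j)^{\beta_{i,j}(I)}$ for any such resolution, satisfy $$\beta_{i,i+j}(I)=\sum_{u\in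 G(I)_j}\binom{i+|\mathrm{set}(u)|-1}{|\mathrm{set}(u)|-1}\qquad\text{for all integers } i\ge 0 \text{ and } j.$$ Hence the total Betti numbers $\beta_i(I)=\sum_j\beta_{i,j}(I)$ satisfy $$\beta_i(I)=\sum_{u\in G(I)}\binom{i+|\mathrm{set}(u)|-1}{|\mathrm{set}(u)|-1}\qquad\text{for all } i\ge 0.$$ -/

import Mathlib

namespace ExtBetti

open Module

/-- The component of degree `m ∈ ℤ` of the exterior algebra `E` of `V`: it is `⋀^m V` for `m ≥ 0`
and zero for `m < 0`. -/
noncomputable def homogeneousPart (K V : Type*) [Field K] [AddCommGroup V] [Module K V] (m : ℤ) :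
    Submodule K (ExteriorAlgebra K V) :=
  if 0 ≤ m then ⋀[K]^(m.toNat) V else ⊥

/-- The graded maximal ideal of the exterior algebra, generated by `V`. -/
noncomputable def maxIdeal (K V : Type*) [Field K] [AddCommGroup V] [Module K V] :
    Ideal (ExteriorAlgebra K V) :=
  Ideal.span (Set.range (ExteriorAlgebra.ι K : V →ₗ[K] ExteriorAlgebra K V))

/-- A graded free resolution `⋯ → F₂ → F₁ → F₀ → I → 0` of a (graded) ideal `I` of the exterior
algebra `E` of `V` by free modules of finite rank. Here `F i` is the free left `E`-module with
standard basis indexed by `Fin (rank i)`, the basis element `b` being given the degree `deg i b`,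
that is `F i = ⨁_b E(-deg i b)`; all maps are `E`-linear and homogeneous of degree `0`. -/
structure GradedFreeResolution {K V : Type*} [Field K] [AddCommGroup V] [Module K V]
    (I : Ideal (ExteriorAlgebra K V)) where
  /-- the rank of `F i` -/
  rank : ℕ → ℕ
  /-- the degrees of the basis elements of `F i` -/
  deg : (i : ℕ) → Fin (rank i) → ℤ
  /-- the differential `F (i + 1) → F i` -/
  d : (i : ℕ) → (Fin (rank (i + 1)) → ExteriorAlgebra K V) →ₗ[ExteriorAlgebra K V]
    (Fin (rank i) → ExteriorAlgebra K V)
  /-- the augmentation `F 0 → I` -/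
  aug : (Fin (rank 0) → ExteriorAlgebra K V) →ₗ[ExteriorAlgebra K V] I
  d_homogeneous : ∀ (i : ℕ) (b : Fin (rank (i + 1))) (c : Fin (rank i)),
    d i (Pi.single b 1) c ∈ homogeneousPart K V (deg (i + 1) b - deg i c)
  aug_homogeneous : ∀ b : Fin (rank 0),
    (aug (Pi.single b 1) : ExteriorAlgebra K V) ∈ homogeneousPart K V (deg 0 b)
  aug_surjective : Function.Surjective aug
  exact_zero : Function.Exact (d 0) aug
  exact_succ : ∀ i : ℕ, Function.Exact (d (i + 1)) (d i)

namespace GradedFreeResolution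

variable {K V : Type*} [Field K] [AddCommGroup V] [Module K V] {I : Ideal (ExteriorAlgebra K V)}

/-- The resolution is minimal: every differential maps `F (i + 1)` into `𝔪 F i`, where `𝔪` is the
graded maximal ideal of the exterior algebra. -/
def IsMinimal (F : GradedFreeResolution I) : Prop :=
  ∀ (i : ℕ) (x : Fin (F.rank (i + 1)) → ExteriorAlgebra K V) (c : Fin (F.rank i)),
    F.d i x c ∈ maxIdeal K V

/-- The multiplicity of `E(-j)` in `F i`; when `F` is minimal, this is the graded Betti number
`β_{i,j}(I)`. -/
def betti (F : GradedFreeResolution I) (i : ℕ) (j : ℤ) : ℕ :=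
  (Finset.univ.filter fun b : Fin (F.rank i) => F.deg i b = j).card

/-- The sum over all degrees `j` of the multiplicity of `E(-j)` in `F i`; when `F` is minimal, this
is the total Betti number `β_i(I) = ∑_j β_{i,j}(I)`. -/
noncomputable def totalBetti (F : GradedFreeResolution I) (i : ℕ) : ℕ :=
  ∑ᶠ j : ℤ, F.betti i j

/-- The sum defining `totalBetti` is finite, and equals the rank of `F i`. -/
theorem totalBetti_eq_rank (F : GradedFreeResolution I) (i : ℕ) : F.totalBetti i = F.rank i := by
  unfold totalBetti
  rw [finsum_eq_sum_of_support_subset (s := Finset.univ.image (F.deg i))]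
  · have h := Finset.card_eq_sum_card_image (F.deg i) (Finset.univ : Finset (Fin (F.rank i)))
    rw [Finset.card_univ, Fintype.card_fin] at h
    exact h.symm
  · intro j hj
    obtain ⟨b, hb⟩ := Finset.card_ne_zero.mp (Function.mem_support.mp hj)
    simp only [Finset.mem_filter, Finset.mem_univ, true_and] at hb
    simp only [Finset.coe_image, Finset.coe_univ, Set.image_univ, Set.mem_range]
    exact ⟨b, hb⟩

end GradedFreeResolution

section Monomial

variable {K V : Type*} [Field K] [AddCommGroup V] [Module K V] {n : ℕ}

/-- The ideal of the exterior algebra generated by the monomials `e_μ`, `μ ∈ G`. Here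
`e.ExteriorAlgebra μ` is the monomial `e_μ`, the product of the `e_i`, `i ∈ μ`, in increasing
order. (A left ideal generated by monomials is two-sided.) -/
noncomputable def monomialIdeal (e : Basis (Fin n) K V) (G : Set (Finset (Fin n))) :
    Ideal (ExteriorAlgebra K V) :=
  Ideal.span ((fun μ => e.ExteriorAlgebra μ) '' G)

/-- `G` is the minimal set `G(I)` of monomial generators of `I` (monomials `e_μ` are represented by
their supports `μ`). In particular `I` is a monomial ideal. -/
def IsMinimalMonomialGenerators (e : Basis (Fin n) K V) (I : Ideal (ExteriorAlgebra K V))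
    (G : Set (Finset (Fin n))) : Prop :=
  Minimal (fun G' => monomialIdeal e G' = I) G

/-- The colon ideal `(u_1, …, u_{k-1}) : (u_k)`; for the first index this is `0 : (u_1)`.
(For ideals generated by monomials, `J : (u)` is the set of all `f` with `f u ∈ J`.) -/
noncomputable def colonIdeal (e : Basis (Fin n) K V) {r : ℕ} (u : Fin r → Finset (Fin n))
    (k : Fin r) : Ideal (ExteriorAlgebra K V) :=
  (monomialIdeal e (u '' Set.Iio k)).colon {e.ExteriorAlgebra (u k)}

/-- `u_1, …, u_r` is an ordering of the minimal monomial generators of `I` with respect to which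
`I` has linear quotients: every colon ideal `(u_1, …, u_{k-1}) : (u_k)` is generated by a subset
of `{e_1, …, e_n}`. -/
structure HasLinearQuotients (e : Basis (Fin n) K V) (I : Ideal (ExteriorAlgebra K V)) {r : ℕ}
    (u : Fin r → Finset (Fin n)) : Prop where
  injective : Function.Injective u
  generators : IsMinimalMonomialGenerators e I (Set.range u)
  colon_linear : ∀ k : Fin r, ∃ S : Set (Fin n),
    colonIdeal e u k = Ideal.span ((fun s => ExteriorAlgebra.ι K (e s)) '' S)

open Classical in
/-- `set(u_k)`, the set of those `s` for which `e_s` belongs to `(u_1, …, u_{k-1}) : (u_k)`. -/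
noncomputable def linSet (e : Basis (Fin n) K V) {r : ℕ} (u : Fin r → Finset (Fin n))
    (k : Fin r) : Finset (Fin n) :=
  Finset.univ.filter fun s => ExteriorAlgebra.ι K (e s) ∈ colonIdeal e u k

end Monomial

end ExtBetti

/-! ### The Cartan complex and its long exact sequence, in terms of dimensions. -/

namespace ExtBetti

open Module

section Cartan

variable {K : Type*} [Field K] {σ : Type*}
  {X Y : Type*} [AddCommGroup X] [Module K X] [AddCommGroup Y] [Module K Y]

theorem finrank_map_add_finrank_inf_ker [FiniteDimensional K X] (g : X →ₗ[K] Y)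
    (W : Submodule K X) :
    finrank K (W.map g) + finrank K (W ⊓ LinearMap.ker g : Submodule K X) = finrank K W := by
  rw [← LinearMap.finrank_range_add_finrank_ker (g.domRestrict W), LinearMap.range_domRestrict,
    LinearMap.ker_domRestrict]
  congr 1
  rw [← Submodule.map_comap_subtype W]
  exact (LinearEquiv.finrank_eq (Submodule.equivMapOfInjective _ W.injective_subtype _)).symm

/-- The chains of homological degree `p` and total degree `q` of the Cartan complex. -/
def chains (σ : Type*) (D : ℤ → Submodule K X) (p : ℕ) (q : ℤ) : Submodule K (Sym σ p → X) :=
  Submodule.pi Set.univ fun _ => D (q - p)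

theorem mem_chains {D : ℤ → Submodule K X} {p : ℕ} {q : ℤ} {f : Sym σ p → X} :
    f ∈ chains σ D p q ↔ ∀ a, f a ∈ D (q - p) := by
  simp [chains, Submodule.mem_pi]

theorem chains_inf_ker {D₁ D₂ : ℤ → Submodule K X} {g : X →ₗ[K] Y}
    (h : ∀ j, D₂ j ⊓ LinearMap.ker g = D₁ j) (p : ℕ) (q : ℤ) :
    chains σ D₂ p q ⊓ LinearMap.ker (g.compLeft (Sym σ p)) = chains σ D₁ p q := by
  ext f
  simp only [Submodule.mem_inf, mem_chains, LinearMap.mem_ker, ← h, funext_iff,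
    LinearMap.compLeft_apply, Function.comp_apply, Pi.zero_apply, forall_and]

theorem chains_map {D₂ : ℤ → Submodule K X} {D₃ : ℤ → Submodule K Y} {g : X →ₗ[K] Y}
    (h : ∀ j, (D₂ j).map g = D₃ j) (p : ℕ) (q : ℤ) :
    (chains σ D₂ p q).map (g.compLeft (Sym σ p)) = chains σ D₃ p q := by
  ext f
  simp only [Submodule.mem_map, mem_chains, ← h]
  constructor
  · rintro ⟨f, hf, rfl⟩ a
    exact ⟨f a, hf a, rfl⟩
  · intro hf
    choose f' hf' hf'' using hf
    exact ⟨f', hf', funext hf''⟩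

/-- Conditions under which the operators `ε` and the grading `D` define a complex. -/
structure IsExteriorAction (ε : σ → X →ₗ[K] X) (D : ℤ → Submodule K X) : Prop where
  anti : ∀ s t x, ε s (ε t x) = -ε t (ε s x)
  sq : ∀ s x, ε s (ε s x) = 0
  mem : ∀ s j x, x ∈ D j → ε s x ∈ D (j + 1)

/-- A linear map `g` presenting the graded space `D₃` with operators `ε'` as the quotient of
`D₂` with operators `ε` by the graded subspace `D₁`. -/
structure IsGradedQuotient (ε : σ → X →ₗ[K] X) (ε' : σ → Y →ₗ[K] Y)
    (D₁ D₂ : ℤ → Submodule K X) (D₃ : ℤ → Submodule K Y) (g : X →ₗ[K] Y) : Prop where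
  left : IsExteriorAction ε D₁
  middle : IsExteriorAction ε D₂
  right : IsExteriorAction ε' D₃
  comm : ∀ s j x, x ∈ D₂ j → g (ε s x) = ε' s (g x)
  ker : ∀ j, D₂ j ⊓ LinearMap.ker g = D₁ j
  map : ∀ j, (D₂ j).map g = D₃ j

theorem IsGradedQuotient.chains_le {ε : σ → X →ₗ[K] X} {ε' : σ → Y →ₗ[K] Y}
    {D₁ D₂ : ℤ → Submodule K X} {D₃ : ℤ → Submodule K Y} {g : X →ₗ[K] Y}
    (h : IsGradedQuotient ε ε' D₁ D₂ D₃ g) (p : ℕ) (q : ℤ) :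
    chains σ D₁ p q ≤ chains σ D₂ p q :=
  chains_inf_ker (σ := σ) h.ker p q ▸ inf_le_left

variable [Fintype σ]

/-- The differential of the Cartan complex of a vector space `X` with operators `ε s`. An element
of the complex in homological degree `p` is a family of elements of `X` indexed by the monomials
of degree `p` in the divided power algebra. -/
def cartanD (ε : σ → X →ₗ[K] X) (p : ℕ) : (Sym σ (p + 1) → X) →ₗ[K] (Sym σ p → X) :=
  LinearMap.pi fun a => ∑ s, ε s ∘ₗ LinearMap.proj (s ::ₛ a)

theorem cartanD_apply (ε : σ → X →ₗ[K] X) (p : ℕ) (f : Sym σ (p + 1) → X) (a : Sym σ p) :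
    cartanD ε p f a = ∑ s, ε s (f (s ::ₛ a)) := by
  simp [cartanD]

/-- Swapping the two indices of the double sum fixes the monomial and changes the sign of the
operator. The hypothesis on squares disposes of the diagonal, which anticommutation alone would not
do in characteristic two. -/
theorem cartanD_cartanD {ε : σ → X →ₗ[K] X} (hanti : ∀ s t x, ε s (ε t x) = -ε t (ε s x))
    (hsq : ∀ s x, ε s (ε s x) = 0) (p : ℕ) (f : Sym σ (p + 2) → X) :
    cartanD ε p (cartanD ε (p + 1) f) = 0 := by
  classical
  funext a
  simp only [cartanD_apply, map_sum, Pi.zero_apply]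
  rw [← Finset.sum_product']
  refine Finset.sum_involution (fun x _ => x.swap) ?_ ?_ ?_ ?_
  · rintro ⟨s, t⟩ -
    simp only [Prod.swap]
    rw [hanti s t, Sym.cons_swap, neg_add_cancel]
  · rintro ⟨s, t⟩ - h h'
    simp only [Prod.swap, Prod.mk.injEq] at h'
    obtain ⟨rfl, -⟩ := h'
    exact h (hsq _ _)
  · simp
  · simp

/-- The cycles of homological degree `p` and total degree `q` of the Cartan complex. -/
def cycles (ε : σ → X →ₗ[K] X) (D : ℤ → Submodule K X) (p : ℕ) (q : ℤ) :
    Submodule K (Sym σ p → X) :=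
  match p with
  | 0 => chains σ D 0 q
  | p + 1 => chains σ D (p + 1) q ⊓ LinearMap.ker (cartanD ε p)

/-- The boundaries of homological degree `p` and total degree `q` of the Cartan complex. -/
def boundaries (ε : σ → X →ₗ[K] X) (D : ℤ → Submodule K X) (p : ℕ) (q : ℤ) :
    Submodule K (Sym σ p → X) :=
  (chains σ D (p + 1) q).map (cartanD ε p)

/-- The dimension of the Cartan homology in homological degree `p` and total degree `q`. -/
noncomputable def cartanDim (ε : σ → X →ₗ[K] X) (D : ℤ → Submodule K X) (p : ℕ) (q : ℤ) : ℕ :=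
  finrank K (cycles ε D p q) - finrank K (boundaries ε D p q)

theorem cycles_le_chains (ε : σ → X →ₗ[K] X) (D : ℤ → Submodule K X) (p : ℕ) (q : ℤ) :
    cycles ε D p q ≤ chains σ D p q := by
  cases p
  · exact le_rfl
  · exact inf_le_left

namespace IsExteriorAction

variable {ε : σ → X →ₗ[K] X} {D : ℤ → Submodule K X}

theorem cartanD_mem (h : IsExteriorAction ε D) {p : ℕ} {q : ℤ} {f : Sym σ (p + 1) → X}
    (hf : f ∈ chains σ D (p + 1) q) : cartanD ε p f ∈ chains σ D p q := by
  rw [mem_chains] at hf ⊢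
  intro a
  rw [cartanD_apply]
  refine Submodule.sum_mem _ fun s _ => ?_
  have := h.mem s _ _ (hf (s ::ₛ a))
  convert this using 2
  push_cast
  ring

theorem boundaries_le_cycles (h : IsExteriorAction ε D) (p : ℕ) (q : ℤ) :
    boundaries ε D p q ≤ cycles ε D p q := by
  rintro _ ⟨f, hf, rfl⟩
  cases p with
  | zero => exact h.cartanD_mem hf
  | succ p => exact ⟨h.cartanD_mem hf, cartanD_cartanD h.anti h.sq p f⟩

variable [FiniteDimensional K X]

theorem cycles_le_boundaries_iff (h : IsExteriorAction ε D) (p : ℕ) (q : ℤ) :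
    cycles ε D p q ≤ boundaries ε D p q ↔ cartanDim ε D p q = 0 := by
  unfold cartanDim
  constructor
  · intro h'
    rw [le_antisymm h' (h.boundaries_le_cycles p q), Nat.sub_self]
  · intro h'
    exact (Submodule.eq_of_le_of_finrank_le (h.boundaries_le_cycles p q)
      (Nat.sub_eq_zero_iff_le.mp h')).ge

/-- Boundaries are cycles, so the truncated subtraction in `cartanDim` is a true one; the dimension
counts use this additive form. -/
theorem cartanDim_add (h : IsExteriorAction ε D) (p : ℕ) (q : ℤ) :
    cartanDim ε D p q + finrank K (boundaries ε D p q) = finrank K (cycles ε D p q) :=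
  Nat.sub_add_cancel (Submodule.finrank_mono (h.boundaries_le_cycles p q))

end IsExteriorAction

namespace IsGradedQuotient

variable {ε : σ → X →ₗ[K] X} {ε' : σ → Y →ₗ[K] Y} {D₁ D₂ : ℤ → Submodule K X}
  {D₃ : ℤ → Submodule K Y} {g : X →ₗ[K] Y}

theorem compLeft_cartanD (h : IsGradedQuotient ε ε' D₁ D₂ D₃ g) {p : ℕ} {q : ℤ}
    {f : Sym σ (p + 1) → X} (hf : f ∈ chains σ D₂ (p + 1) q) :
    g.compLeft (Sym σ p) (cartanD ε p f) = cartanD ε' p (g.compLeft (Sym σ (p + 1)) f) := by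
  funext a
  simp only [LinearMap.compLeft_apply, Function.comp_apply, cartanD_apply, map_sum]
  exact Finset.sum_congr rfl fun s _ => h.comm s _ _ (mem_chains.mp hf _)

/-- Cycles are left exact because the subspace and the whole space share the same differential.
Right exactness fails in general; the obstruction is the connecting homomorphism. -/
theorem cycles_inf_ker (h : IsGradedQuotient ε ε' D₁ D₂ D₃ g) (p : ℕ) (q : ℤ) :
    cycles ε D₂ p q ⊓ LinearMap.ker (g.compLeft (Sym σ p)) = cycles ε D₁ p q := by
  cases p with
  | zero => exact chains_inf_ker h.ker 0 q
  | succ p =>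
    simp only [cycles]
    rw [inf_right_comm, chains_inf_ker h.ker]

theorem boundaries_map (h : IsGradedQuotient ε ε' D₁ D₂ D₃ g) (p : ℕ) (q : ℤ) :
    (boundaries ε D₂ p q).map (g.compLeft (Sym σ p)) = boundaries ε' D₃ p q := by
  unfold boundaries
  rw [← chains_map h.map]
  apply le_antisymm
  · rintro _ ⟨_, ⟨f, hf, rfl⟩, rfl⟩
    exact ⟨_, ⟨f, hf, rfl⟩, (h.compLeft_cartanD hf).symm⟩
  · rintro _ ⟨_, ⟨f, hf, rfl⟩, rfl⟩
    exact ⟨_, ⟨f, hf, rfl⟩, h.compLeft_cartanD hf⟩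

theorem cycles_map_le (h : IsGradedQuotient ε ε' D₁ D₂ D₃ g) (p : ℕ) (q : ℤ) :
    (cycles ε D₂ p q).map (g.compLeft (Sym σ p)) ≤ cycles ε' D₃ p q := by
  rintro _ ⟨f, hf, rfl⟩
  have hf' : g.compLeft (Sym σ p) f ∈ chains σ D₃ p q :=
    chains_map (σ := σ) h.map p q ▸ ⟨f, cycles_le_chains _ _ _ _ hf, rfl⟩
  cases p with
  | zero => exact hf'
  | succ p =>
    refine ⟨hf', ?_⟩
    rw [SetLike.mem_coe, LinearMap.mem_ker, ← h.compLeft_cartanD hf.1, LinearMap.mem_ker.mp hf.2,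
      map_zero]

variable [FiniteDimensional K X] [FiniteDimensional K Y]

/-- The connecting homomorphism is zero when its source or its target is zero. -/
theorem cycles_map_eq (h : IsGradedQuotient ε ε' D₁ D₂ D₃ g) (p : ℕ) (q : ℤ)
    (h0 : cartanDim ε' D₃ (p + 1) q = 0 ∨ cartanDim ε D₁ p q = 0) :
    (cycles ε D₂ (p + 1) q).map (g.compLeft (Sym σ (p + 1))) = cycles ε' D₃ (p + 1) q := by
  refine le_antisymm (h.cycles_map_le _ _) fun z hz => ?_
  rcases h0 with h0 | h0
  · have hz' := (h.right.cycles_le_boundaries_iff _ _).mpr h0 hz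
    rw [← h.boundaries_map] at hz'
    exact Submodule.map_mono (h.middle.boundaries_le_cycles _ _) hz'
  -- For a lift `b` of the cycle, `cartanD ε p b` represents its image under the connecting
  -- homomorphism. It bounds some `a` in `D₁`, and `b - a` is a cycle lifting the same element.
  · obtain ⟨b, hb, rfl⟩ := (chains_map h.map _ _).ge (cycles_le_chains _ _ _ _ hz)
    have hb' : cartanD ε p b ∈ cycles ε D₁ p q := by
      rw [← h.cycles_inf_ker]
      refine ⟨h.middle.boundaries_le_cycles _ _ ⟨b, hb, rfl⟩, ?_⟩
      rw [SetLike.mem_coe, LinearMap.mem_ker, h.compLeft_cartanD hb]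
      exact hz.2
    obtain ⟨a, ha, hab⟩ := (h.left.cycles_le_boundaries_iff _ _).mpr h0 hb'
    refine ⟨b - a, ⟨sub_mem hb (h.chains_le _ _ ha), ?_⟩, ?_⟩
    · rw [SetLike.mem_coe, LinearMap.mem_ker, map_sub, hab, sub_self]
    · rw [map_sub, sub_eq_self]
      rw [← chains_inf_ker h.ker] at ha
      exact ha.2

/-- This is injectivity of the map from the homology of `D₁` to that of `D₂` in degree `p`: its
kernel is the image of the connecting homomorphism, which vanishes. -/
theorem boundaries_inf_ker (h : IsGradedQuotient ε ε' D₁ D₂ D₃ g) (p : ℕ) (q : ℤ)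
    (h0 : cartanDim ε' D₃ (p + 1) q = 0 ∨ cartanDim ε D₁ p q = 0) :
    boundaries ε D₂ p q ⊓ LinearMap.ker (g.compLeft (Sym σ p)) = boundaries ε D₁ p q := by
  apply le_antisymm
  · rintro x ⟨hx, hx'⟩
    rcases h0 with h0 | h0
    -- The image of `b` is a cycle, hence a boundary, and lifts to a boundary `y` of `D₂`.
    -- Subtracting `y` moves `b` into `D₁` without changing its differential.
    · obtain ⟨b, hb, rfl⟩ := hx
      have hz : g.compLeft (Sym σ (p + 1)) b ∈ cycles ε' D₃ (p + 1) q := by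
        refine ⟨chains_map (σ := σ) h.map (p + 1) q ▸ ⟨b, hb, rfl⟩, ?_⟩
        rw [SetLike.mem_coe, LinearMap.mem_ker, ← h.compLeft_cartanD hb]
        exact hx'
      have hz' := (h.right.cycles_le_boundaries_iff _ _).mpr h0 hz
      rw [← h.boundaries_map] at hz'
      obtain ⟨y, hy, hy'⟩ := hz'
      refine ⟨b - y, ?_, ?_⟩
      · rw [← chains_inf_ker h.ker]
        refine ⟨sub_mem hb (cycles_le_chains _ _ _ _ (h.middle.boundaries_le_cycles _ _ hy)), ?_⟩
        rw [SetLike.mem_coe, LinearMap.mem_ker, map_sub, hy', sub_self]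
      · rw [map_sub, sub_eq_self]
        exact (h.middle.boundaries_le_cycles _ _ hy).2
    · refine (h.left.cycles_le_boundaries_iff _ _).mpr h0 ?_
      rw [← h.cycles_inf_ker]
      exact ⟨h.middle.boundaries_le_cycles _ _ hx, hx'⟩
  · refine le_inf (Submodule.map_mono (h.chains_le _ _)) ?_
    refine (h.left.boundaries_le_cycles p q).trans ?_
    rw [← h.cycles_inf_ker]
    exact inf_le_right

/-- Cartan homology is additive when the connecting homomorphisms vanish. -/
theorem cartanDim_eq_add (h : IsGradedQuotient ε ε' D₁ D₂ D₃ g) (q : ℤ)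
    (h0 : ∀ p, cartanDim ε' D₃ (p + 1) q = 0 ∨ cartanDim ε D₁ p q = 0) (p : ℕ) :
    cartanDim ε D₂ p q = cartanDim ε D₁ p q + cartanDim ε' D₃ p q := by
  have hz : (cycles ε D₂ p q).map (g.compLeft (Sym σ p)) = cycles ε' D₃ p q := by
    cases p with
    | zero => exact chains_map h.map 0 q
    | succ p => exact h.cycles_map_eq p q (h0 p)
  have e1 := finrank_map_add_finrank_inf_ker (g.compLeft (Sym σ p)) (cycles ε D₂ p q)
  have e2 := finrank_map_add_finrank_inf_ker (g.compLeft (Sym σ p)) (boundaries ε D₂ p q)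
  rw [hz, h.cycles_inf_ker] at e1
  rw [h.boundaries_map, h.boundaries_inf_ker p q (h0 p)] at e2
  have := h.left.cartanDim_add p q
  have := h.middle.cartanDim_add p q
  have := h.right.cartanDim_add p q
  lia

/-- The connecting homomorphism is an isomorphism when the two maps next to it vanish. -/
theorem cartanDim_succ_eq (h : IsGradedQuotient ε ε' D₁ D₂ D₃ g) (p : ℕ) (q : ℤ)
    (h0 : cartanDim ε D₂ (p + 1) q = 0) (h1 : cycles ε D₁ p q ≤ boundaries ε D₂ p q) :
    cartanDim ε' D₃ (p + 1) q = cartanDim ε D₁ p q := by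
  set G := g.compLeft (Sym σ (p + 1))
  -- `W` is the graph-like space behind the connecting homomorphism: `G` maps it onto the cycles of
  -- the quotient, and the differential maps it onto the cycles of `D₁`, the latter by `h1`.
  -- Comparing the two kernels gives the equality of dimensions.
  set W := chains σ D₂ (p + 1) q ⊓ (cycles ε' D₃ (p + 1) q).comap G with hW
  have e1 := finrank_map_add_finrank_inf_ker G W
  have e2 := finrank_map_add_finrank_inf_ker (cartanD ε p) W
  have e3 := finrank_map_add_finrank_inf_ker G (boundaries ε D₂ (p + 1) q)
  have e4 := finrank_map_add_finrank_inf_ker (cartanD ε p) (chains σ D₁ (p + 1) q)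
  have a1 : W.map G = cycles ε' D₃ (p + 1) q := by
    refine le_antisymm (Submodule.map_le_iff_le_comap.mpr inf_le_right) fun z hz => ?_
    obtain ⟨b, hb, rfl⟩ := (chains_map h.map _ _).ge (cycles_le_chains _ _ _ _ hz)
    exact ⟨b, ⟨hb, hz⟩, rfl⟩
  have a2 : W ⊓ LinearMap.ker G = chains σ D₁ (p + 1) q := by
    rw [← chains_inf_ker h.ker]
    refine le_antisymm (inf_le_inf_right _ inf_le_left) ?_
    rintro x ⟨hx, hx'⟩
    refine ⟨⟨hx, ?_⟩, hx'⟩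
    rw [SetLike.mem_coe, Submodule.mem_comap, LinearMap.mem_ker.mp hx']
    exact zero_mem _
  have hmem : ∀ {b}, b ∈ chains σ D₂ (p + 1) q →
      (b ∈ W ↔ g.compLeft (Sym σ p) (cartanD ε p b) = 0) := by
    intro b hb
    rw [h.compLeft_cartanD hb]
    refine ⟨fun hb' => hb'.2.2, fun hb' => ⟨hb, ?_, hb'⟩⟩
    exact chains_map (σ := σ) h.map (p + 1) q ▸ ⟨b, hb, rfl⟩
  have a3 : W.map (cartanD ε p) = cycles ε D₁ p q := by
    rw [← h.cycles_inf_ker]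
    apply le_antisymm
    · rintro _ ⟨b, hb, rfl⟩
      exact ⟨h.middle.boundaries_le_cycles _ _ ⟨b, hb.1, rfl⟩, (hmem hb.1).mp hb⟩
    · rintro x ⟨hx, hx'⟩
      obtain ⟨b, hb, rfl⟩ := h1 ((h.cycles_inf_ker p q).le ⟨hx, hx'⟩)
      exact ⟨b, (hmem hb).mpr hx', rfl⟩
  have hzb : cycles ε D₂ (p + 1) q = boundaries ε D₂ (p + 1) q :=
    le_antisymm ((h.middle.cycles_le_boundaries_iff _ _).mpr h0) (h.middle.boundaries_le_cycles _ _)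
  have a4 : W ⊓ LinearMap.ker (cartanD ε p) = boundaries ε D₂ (p + 1) q := by
    rw [← hzb]
    refine le_antisymm (inf_le_inf_right _ inf_le_left) ?_
    rintro x ⟨hx, hx'⟩
    refine ⟨(hmem hx).mpr ?_, hx'⟩
    rw [LinearMap.mem_ker.mp hx', map_zero]
  have a5 : boundaries ε D₂ (p + 1) q ⊓ LinearMap.ker G =
      chains σ D₁ (p + 1) q ⊓ LinearMap.ker (cartanD ε p) := by
    rw [← hzb, h.cycles_inf_ker]
    rfl
  rw [a1, a2] at e1
  rw [a3, a4] at e2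
  rw [h.boundaries_map, a5] at e3
  have e5 : finrank K (boundaries ε D₁ p q) = finrank K ((chains σ D₁ (p + 1) q).map
    (cartanD ε p)) := rfl
  have := h.left.cartanDim_add p q
  have := h.right.cartanDim_add (p + 1) q
  lia

/-- In degree zero every chain of the quotient is a cycle and lifts, so homology maps onto homology;
`h1` says that `D₁` contributes nothing to the kernel. -/
theorem cartanDim_zero_eq (h : IsGradedQuotient ε ε' D₁ D₂ D₃ g) (q : ℤ)
    (h1 : cycles ε D₁ 0 q ≤ boundaries ε D₂ 0 q) : cartanDim ε' D₃ 0 q = cartanDim ε D₂ 0 q := by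
  have e1 := finrank_map_add_finrank_inf_ker (g.compLeft (Sym σ 0)) (cycles ε D₂ 0 q)
  have e2 := finrank_map_add_finrank_inf_ker (g.compLeft (Sym σ 0)) (boundaries ε D₂ 0 q)
  have a1 : (cycles ε D₂ 0 q).map (g.compLeft (Sym σ 0)) = cycles ε' D₃ 0 q := chains_map h.map 0 q
  have a2 : boundaries ε D₂ 0 q ⊓ LinearMap.ker (g.compLeft (Sym σ 0)) = cycles ε D₁ 0 q := by
    refine le_antisymm ?_ (le_inf h1 ?_)
    · rw [← h.cycles_inf_ker]
      exact inf_le_inf_right _ (h.middle.boundaries_le_cycles 0 q)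
    · rw [← h.cycles_inf_ker]
      exact inf_le_right
  rw [a1, h.cycles_inf_ker] at e1
  rw [h.boundaries_map, a2] at e2
  have := h.middle.cartanDim_add 0 q
  have := h.right.cartanDim_add 0 q
  lia

end IsGradedQuotient

end Cartan

end ExtBetti

/-! ### Cartan homology in the presence of contractions. -/

namespace ExtBetti

open Module

theorem card_finset_sym {σ : Type*} [DecidableEq σ] (S : Finset σ) (p : ℕ) :
    (S.sym p).card = S.card.multichoose p := by
  conv_lhs => rw [← Finset.attach_map_val (s := S)]
  rw [Finset.sym_map, Finset.card_map, Finset.attach_eq_univ, Finset.sym_univ, Finset.card_univ,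
    Sym.card_sym_eq_multichoose, Fintype.card_coe]

section Koszul

variable {K : Type*} [Field K] {σ : Type*} [DecidableEq σ]
  {X : Type*} [AddCommGroup X] [Module K X]

/-- Families with values annihilated by the contractions with `t ∈ T`, and supported on monomials
without variables in `T`. -/
def reducedFamilies (δ : σ → X →ₗ[K] X) (T : Finset σ) (p : ℕ) : Submodule K (Sym σ p → X) where
  carrier := {f | ∀ t ∈ T, ∀ a, δ t (f a) = 0 ∧ (t ∈ a → f a = 0)}
  add_mem' {f g} hf hg t ht a := by
    constructor
    · simp [(hf t ht a).1, (hg t ht a).1]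
    · intro h
      simp [(hf t ht a).2 h, (hg t ht a).2 h]
  zero_mem' t ht a := by simp
  smul_mem' c f hf t ht a := by
    constructor
    · simp [(hf t ht a).1]
    · intro h
      simp [(hf t ht a).2 h]

theorem mem_reducedFamilies {σ : Type*} {δ : σ → X →ₗ[K] X} {T : Finset σ} {p : ℕ}
    {f : Sym σ p → X} :
    f ∈ reducedFamilies δ T p ↔ ∀ t ∈ T, ∀ a, δ t (f a) = 0 ∧ (t ∈ a → f a = 0) :=
  Iff.rfl

/-- Operators `ε s` (`s ∈ T`) and `δ t` (`t ∈ T`) behaving like multiplications by, and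
contractions with, the vectors of a basis of a vector space. -/
structure HasContractions (ε δ : σ → X →ₗ[K] X) (T : Finset σ) (D : ℤ → Submodule K X) : Prop
    extends IsExteriorAction ε D where
  eq_zero : ∀ s ∉ T, ε s = 0
  contract : ∀ s, ∀ t ∈ T, ∀ x, δ t (ε s x) + ε s (δ t x) = if s = t then x else 0
  contract_anti : ∀ s t x, δ s (δ t x) = -δ t (δ s x)
  contract_sq : ∀ s x, δ s (δ s x) = 0
  contract_mem : ∀ t ∈ T, ∀ j x, x ∈ D j → δ t x ∈ D (j - 1)

/-- The homotopy which contracts with a basis vector `t` and multiplies by the divided power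
variable `t`. -/
def homotopy (δ : σ → X →ₗ[K] X) (t : σ) (p : ℕ) (f : Sym σ p → X) (b : Sym σ (p + 1)) : X :=
  if h : t ∈ b then δ t (f (b.erase t h)) else 0

/-- The projection onto the families that do not involve the basis vector `t`. -/
def restrictAway (ε δ : σ → X →ₗ[K] X) (t : σ) (p : ℕ) (f : Sym σ p → X) (a : Sym σ p) : X :=
  if t ∈ a then 0 else δ t (ε t (f a))

theorem homotopy_cons (δ : σ → X →ₗ[K] X) (t : σ) (p : ℕ) (f : Sym σ p → X) (a : Sym σ p) :
    homotopy δ t p f (t ::ₛ a) = δ t (f a) := by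
  rw [homotopy, dif_pos (Sym.mem_cons_self t a), Sym.erase_cons_head]

theorem homotopy_zero (δ : σ → X →ₗ[K] X) (t : σ) (p : ℕ) : homotopy δ t p 0 = 0 := by
  funext b
  simp [homotopy]

/-- The vectors in a graded piece annihilated by all contractions. -/
def primitives {σ : Type*} (δ : σ → X →ₗ[K] X) (T : Finset σ)
    (D : ℤ → Submodule K X) (j : ℤ) : Submodule K X :=
  D j ⊓ ⨅ t ∈ T, LinearMap.ker (δ t)

namespace HasContractions

variable {ε δ : σ → X →ₗ[K] X} {T : Finset σ} {D : ℤ → Submodule K X}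

theorem contract_mul (h : HasContractions ε δ T D) (s : σ) {t : σ} (ht : t ∈ T) (x : X) :
    ε s (δ t x) = (if s = t then x else 0) - δ t (ε s x) :=
  eq_sub_of_add_eq' (h.contract s t ht x)

theorem homotopy_mem (h : HasContractions ε δ T D) {t : σ} (ht : t ∈ T) {p : ℕ} {q : ℤ}
    {f : Sym σ p → X} (hf : f ∈ chains σ D p q) : homotopy δ t p f ∈ chains σ D (p + 1) q := by
  rw [mem_chains] at hf ⊢
  intro b
  unfold homotopy
  split_ifs with hb
  · convert h.contract_mem t ht _ _ (hf (b.erase t hb)) using 2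
    push_cast
    ring
  · exact zero_mem _

theorem restrictAway_eq_self (h : HasContractions ε δ T D) {t : σ} (ht : t ∈ T)
    {p : ℕ} {f : Sym σ p → X} (hf : f ∈ reducedFamilies δ T p) :
    restrictAway ε δ t p f = f := by
  funext a
  unfold restrictAway
  split_ifs with ha
  · exact ((hf t ht a).2 ha).symm
  · have := h.contract t t ht (f a)
    rwa [(hf t ht a).1, map_zero, add_zero, if_pos rfl] at this

theorem restrictAway_mem_reducedFamilies (h : HasContractions ε δ T D) {t : σ} (ht : t ∈ T)
    {T' : Finset σ} (hT' : T' ⊆ T) {p : ℕ} {f : Sym σ p → X} (hf : f ∈ reducedFamilies δ T' p) :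
    restrictAway ε δ t p f ∈ reducedFamilies δ (insert t T') p := by
  rw [mem_reducedFamilies] at hf ⊢
  intro s hs a
  unfold restrictAway
  by_cases hst : s = t
  · subst hst
    split_ifs with ha
    · simp
    · exact ⟨h.contract_sq _ _, fun ha' => absurd ha' ha⟩
  · have hs' : s ∈ T' := (Finset.mem_insert.mp hs).resolve_left hst
    split_ifs with ha
    · simp
    · constructor
      · have := h.contract t s (hT' hs') (f a)
        rw [(hf s hs' a).1, map_zero, add_zero, if_neg (Ne.symm hst)] at this
        rw [h.contract_anti, this, map_zero, neg_zero]
      · intro ha'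
        rw [(hf s hs' a).2 ha', map_zero, map_zero]

variable [Fintype σ]

theorem cartanD_homotopy_of_notMem (h : HasContractions ε δ T D) {t : σ} (ht : t ∈ T) {p : ℕ}
    (f : Sym σ p → X) {a : Sym σ p} (ha : t ∉ a) :
    cartanD ε p (homotopy δ t p f) a = f a - restrictAway ε δ t p f a := by
  rw [cartanD_apply, Finset.sum_eq_single t, homotopy_cons, restrictAway, if_neg ha,
    h.contract_mul t ht, if_pos rfl]
  · intro s _ hst
    rw [homotopy, dif_neg, map_zero]
    rw [Sym.mem_cons]
    exact not_or.mpr ⟨hst.symm, ha⟩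
  · simp

theorem cartanD_homotopy_zero (h : HasContractions ε δ T D) {t : σ} (ht : t ∈ T)
    (f : Sym σ 0 → X) :
    cartanD ε 0 (homotopy δ t 0 f) = f - restrictAway ε δ t 0 f := by
  funext a
  refine h.cartanD_homotopy_of_notMem ht f ?_
  rw [Sym.eq_nil_of_card_zero a]
  exact Sym.notMem_nil t

/-- At a monomial divisible by `t`, the Leibniz rule collapses the sum to its term with index `t`,
which returns `f`. At any other monomial only that term survives in the first summand, and the
second is zero. -/
theorem cartanD_homotopy_succ (h : HasContractions ε δ T D) {t : σ} (ht : t ∈ T) (p : ℕ)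
    (f : Sym σ (p + 1) → X) :
    cartanD ε (p + 1) (homotopy δ t (p + 1) f) + homotopy δ t p (cartanD ε p f) =
      f - restrictAway ε δ t (p + 1) f := by
  funext a
  by_cases ha : t ∈ a
  · obtain ⟨b, rfl⟩ := Sym.exists_cons_of_mem ha
    rw [Pi.add_apply, homotopy_cons, cartanD_apply, cartanD_apply, map_sum,
      ← Finset.sum_add_distrib, Pi.sub_apply, restrictAway, if_pos ha, sub_zero]
    have : ∀ s, ε s (homotopy δ t (p + 1) f (s ::ₛ t ::ₛ b)) + δ t (ε s (f (s ::ₛ b))) =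
        if s = t then f (s ::ₛ b) else 0 := by
      intro s
      rw [Sym.cons_swap, homotopy_cons, add_comm, h.contract s t ht]
    simp [this]
  · rw [Pi.add_apply, h.cartanD_homotopy_of_notMem ht f ha, homotopy, dif_neg ha, add_zero]
    rfl

/-- The projection is the identity minus a null-homotopic map, hence a chain map. Degree zero is
separate because the homotopy formula has only one term there. -/
theorem restrictAway_cartanD (h : HasContractions ε δ T D) {t : σ} (ht : t ∈ T) (p : ℕ)
    (f : Sym σ (p + 1) → X) :
    restrictAway ε δ t p (cartanD ε p f) = cartanD ε p (restrictAway ε δ t (p + 1) f) := by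
  have e1 := congrArg (cartanD ε p) (h.cartanD_homotopy_succ ht p f)
  rw [map_add, map_sub, cartanD_cartanD h.anti h.sq, zero_add] at e1
  cases p with
  | zero =>
    have e2 := h.cartanD_homotopy_zero ht (cartanD ε 0 f)
    rw [e1] at e2
    exact (sub_right_injective e2).symm
  | succ p =>
    have e2 := h.cartanD_homotopy_succ ht p (cartanD ε (p + 1) f)
    rw [e1, cartanD_cartanD h.anti h.sq, homotopy_zero, add_zero] at e2
    exact (sub_right_injective e2).symm

theorem sub_restrictAway_mem_boundaries (h : HasContractions ε δ T D) {t : σ} (ht : t ∈ T)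
    {p : ℕ} {q : ℤ} {f : Sym σ p → X} (hf : f ∈ cycles ε D p q) :
    f - restrictAway ε δ t p f ∈ boundaries ε D p q := by
  refine ⟨_, h.homotopy_mem ht (cycles_le_chains _ _ _ _ hf), ?_⟩
  cases p with
  | zero => exact h.cartanD_homotopy_zero ht f
  | succ p =>
    rw [← h.cartanD_homotopy_succ ht p f, LinearMap.mem_ker.mp hf.2, homotopy_zero, add_zero]

/-- Project away from the elements of `T'` one after another: each projection changes a cycle by a
boundary and, by anticommutation, keeps what the earlier ones achieved. -/
theorem exists_reduced_cycle (h : HasContractions ε δ T D) {p : ℕ} {q : ℤ} {f : Sym σ p → X}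
    (hf : f ∈ cycles ε D p q) {T' : Finset σ} (hT' : T' ⊆ T) :
    ∃ g ∈ cycles ε D p q, g ∈ reducedFamilies δ T' p ∧ f - g ∈ boundaries ε D p q := by
  induction T' using Finset.induction_on with
  | empty =>
    refine ⟨f, hf, fun t ht => absurd ht (Finset.notMem_empty t), ?_⟩
    rw [sub_self]
    exact zero_mem _
  | insert t T' _ ih =>
    have ht := hT' (Finset.mem_insert_self t T')
    have hT'' := (Finset.subset_insert t T').trans hT'
    obtain ⟨g, hg, hg', hfg⟩ := ih hT''
    have hb := h.sub_restrictAway_mem_boundaries ht hg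
    refine ⟨restrictAway ε δ t p g, ?_, h.restrictAway_mem_reducedFamilies ht hT'' hg', ?_⟩
    · simpa using sub_mem hg (h.boundaries_le_cycles p q hb)
    · simpa using add_mem hfg hb

/-- The projections are chain maps fixing `g`, so a preimage of `g` may be projected until it is
reduced too. The differential of a reduced family is zero: for `s ∈ T` the family vanishes on
multiples of `s`, and for other `s` the operator vanishes. -/
theorem reduced_boundary_eq_zero (h : HasContractions ε δ T D) {p : ℕ} {q : ℤ}
    {g : Sym σ p → X} (hg : g ∈ reducedFamilies δ T p) (hb : g ∈ boundaries ε D p q) : g = 0 := by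
  have key : ∀ T' ⊆ T, ∃ y ∈ reducedFamilies δ T' (p + 1), cartanD ε p y = g := by
    intro T' hT'
    induction T' using Finset.induction_on with
    | empty =>
      obtain ⟨y, hy, hyg⟩ := hb
      exact ⟨y, fun t ht => absurd ht (Finset.notMem_empty t), hyg⟩
    | insert t T' _ ih =>
      have ht := hT' (Finset.mem_insert_self t T')
      have hT'' := (Finset.subset_insert t T').trans hT'
      obtain ⟨y, hy, hyg⟩ := ih hT''
      refine ⟨_, h.restrictAway_mem_reducedFamilies ht hT'' hy, ?_⟩
      rw [← h.restrictAway_cartanD ht, hyg, h.restrictAway_eq_self ht hg]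
  obtain ⟨y, hy, rfl⟩ := key T subset_rfl
  funext a
  rw [cartanD_apply, Pi.zero_apply]
  refine Finset.sum_eq_zero fun s _ => ?_
  by_cases hs : s ∈ T
  · rw [(hy s hs (s ::ₛ a)).2 (Sym.mem_cons_self s a), map_zero]
  · rw [h.eq_zero s hs, LinearMap.zero_apply]

theorem reduced_le_cycles (h : HasContractions ε δ T D) (p : ℕ) (q : ℤ) :
    chains σ D p q ⊓ reducedFamilies δ T p ≤ cycles ε D p q := by
  rintro f ⟨hf, hf'⟩
  cases p with
  | zero => exact hf
  | succ p =>
    refine ⟨hf, ?_⟩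
    rw [SetLike.mem_coe, LinearMap.mem_ker]
    funext a
    rw [cartanD_apply, Pi.zero_apply]
    refine Finset.sum_eq_zero fun s _ => ?_
    by_cases hs : s ∈ T
    · rw [(hf' s hs (s ::ₛ a)).2 (Sym.mem_cons_self s a), map_zero]
    · rw [h.eq_zero s hs, LinearMap.zero_apply]

variable [FiniteDimensional K X]

theorem cartanDim_eq_finrank_reduced (h : HasContractions ε δ T D) (p : ℕ) (q : ℤ) :
    cartanDim ε D p q =
      finrank K (chains σ D p q ⊓ reducedFamilies δ T p : Submodule K (Sym σ p → X)) := by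
  have e := Submodule.finrank_sup_add_finrank_inf_eq (boundaries ε D p q)
    (chains σ D p q ⊓ reducedFamilies δ T p)
  have e1 : boundaries ε D p q ⊔ (chains σ D p q ⊓ reducedFamilies δ T p) = cycles ε D p q := by
    refine le_antisymm (sup_le (h.boundaries_le_cycles p q) (h.reduced_le_cycles p q)) ?_
    intro f hf
    obtain ⟨g, hg, hg', hfg⟩ := h.exists_reduced_cycle hf subset_rfl
    exact Submodule.mem_sup.mpr
      ⟨_, hfg, g, ⟨cycles_le_chains _ _ _ _ hg, hg'⟩, sub_add_cancel f g⟩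
  have e2 : boundaries ε D p q ⊓ (chains σ D p q ⊓ reducedFamilies δ T p) = ⊥ := by
    rw [eq_bot_iff]
    rintro g ⟨hg, -, hg'⟩
    exact h.reduced_boundary_eq_zero hg' hg
  rw [e1, e2, finrank_bot, add_zero] at e
  have := h.cartanDim_add p q
  lia

/-- Reduced families represent each homology class exactly once, and such a family is an arbitrary
function from the monomials of degree `p` outside `T` to the primitives. -/
theorem cartanDim_eq (h : HasContractions ε δ T D) (p : ℕ) (q : ℤ) :
    cartanDim ε D p q = (Tᶜ.card.multichoose p) * finrank K (primitives δ T D (q - p)) := by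
  rw [h.cartanDim_eq_finrank_reduced]
  have hmem : ∀ f : Sym σ p → X, f ∈ chains σ D p q ⊓ reducedFamilies δ T p ↔
      (∀ a, f a ∈ primitives δ T D (q - p)) ∧ ∀ a, a ∉ (Tᶜ).sym p → f a = 0 := by
    intro f
    simp only [Submodule.mem_inf, mem_chains, mem_reducedFamilies, primitives,
      Submodule.mem_iInf, LinearMap.mem_ker, Finset.mem_sym_iff, Finset.mem_compl]
    constructor
    · rintro ⟨h1, h2⟩
      refine ⟨fun a => ⟨h1 a, fun t ht => (h2 t ht a).1⟩, fun a ha => ?_⟩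
      push Not at ha
      obtain ⟨t, hta, ht⟩ := ha
      exact (h2 t ht a).2 hta
    · rintro ⟨h1, h2⟩
      exact ⟨fun a => (h1 a).1, fun t ht a =>
        ⟨(h1 a).2 t ht, fun hta => h2 a fun h' => h' t hta ht⟩⟩
  let φ : (chains σ D p q ⊓ reducedFamilies δ T p : Submodule K (Sym σ p → X)) ≃ₗ[K]
      ((Tᶜ).sym p → primitives δ T D (q - p)) :=
    { toFun := fun f a => ⟨f.1 a, ((hmem f.1).mp f.2).1 a⟩
      map_add' := fun f g => rfl
      map_smul' := fun c f => rfl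
      invFun := fun g => ⟨fun a => if ha : a ∈ (Tᶜ).sym p then (g ⟨a, ha⟩ : X) else 0, by
        rw [hmem]
        constructor
        · intro a
          split_ifs
          · exact (g _).2
          · exact zero_mem _
        · intro a ha
          rw [dif_neg ha]⟩
      left_inv := by
        intro f
        ext a
        dsimp only
        split_ifs with ha
        · rfl
        · exact (((hmem f.1).mp f.2).2 a ha).symm
      right_inv := by
        intro g
        ext a
        simp }
  rw [φ.finrank_eq, Module.finrank_pi_fintype, Finset.sum_const, smul_eq_mul, Finset.card_univ,
    Fintype.card_coe, card_finset_sym]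

end HasContractions

end Koszul

end ExtBetti

/-! ### Coordinate subspaces and coordinate projections. -/

namespace ExtBetti

open Module

section BasisSpan

variable {K : Type*} [Field K] {κ : Type*} {X : Type*} [AddCommGroup X] [Module K X]
  (b : Basis κ K X)

/-- The span of the basis vectors with index in `P`. -/
def basisSpan (P : Set κ) : Submodule K X :=
  Submodule.span K (b '' P)

theorem mem_basisSpan {P : Set κ} {x : X} : x ∈ basisSpan b P ↔ ∀ μ ∉ P, b.repr x μ = 0 := by
  rw [basisSpan, Basis.mem_span_image]
  constructor
  · intro h μ hμ
    by_contra h'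
    exact hμ (h (Finsupp.mem_support_iff.mpr h'))
  · intro h μ hμ
    by_contra h'
    exact Finsupp.mem_support_iff.mp hμ (h μ h')

theorem basis_mem_basisSpan {P : Set κ} {μ : κ} (h : μ ∈ P) : b μ ∈ basisSpan b P :=
  Submodule.subset_span ⟨μ, h, rfl⟩

theorem basis_mem_basisSpan_iff {P : Set κ} {μ : κ} : b μ ∈ basisSpan b P ↔ μ ∈ P := by
  refine ⟨fun h => ?_, basis_mem_basisSpan b⟩
  by_contra h'
  have := (mem_basisSpan b).mp h μ h'
  simp at this

theorem basisSpan_inf (P Q : Set κ) : basisSpan b P ⊓ basisSpan b Q = basisSpan b (P ∩ Q) := by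
  ext x
  simp only [Submodule.mem_inf, mem_basisSpan, Set.mem_inter_iff, not_and_or]
  exact ⟨fun h μ hμ => hμ.elim (h.1 μ) (h.2 μ), fun h => ⟨fun μ hμ => h μ (Or.inl hμ),
    fun μ hμ => h μ (Or.inr hμ)⟩⟩

theorem basisSpan_mono {P Q : Set κ} (h : P ⊆ Q) : basisSpan b P ≤ basisSpan b Q :=
  Submodule.span_mono (Set.image_mono h)

theorem basisSpan_empty : basisSpan b ∅ = ⊥ := by
  simp [basisSpan]

theorem basisSpan_le_comap {Y : Type*} [AddCommGroup Y] [Module K Y] {P : Set κ} (f : X →ₗ[K] Y)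
    {W : Submodule K Y} (h : ∀ μ ∈ P, f (b μ) ∈ W) {x : X} (hx : x ∈ basisSpan b P) : f x ∈ W := by
  have : basisSpan b P ≤ W.comap f := Submodule.span_le.mpr (by rintro _ ⟨μ, hμ, rfl⟩; exact h μ hμ)
  exact this hx

open Classical in
/-- The projection onto the span of the basis vectors with index in `P`. -/
noncomputable def basisProj (P : Set κ) : X →ₗ[K] X :=
  b.constr K fun μ => if μ ∈ P then b μ else 0

theorem basisProj_basis_of_mem {P : Set κ} {μ : κ} (h : μ ∈ P) : basisProj b P (b μ) = b μ := by
  rw [basisProj, Basis.constr_basis, if_pos h]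

theorem basisProj_basis_of_notMem {P : Set κ} {μ : κ} (h : μ ∉ P) : basisProj b P (b μ) = 0 := by
  rw [basisProj, Basis.constr_basis, if_neg h]

theorem repr_basisProj_of_mem {P : Set κ} {μ : κ} (h : μ ∈ P) (x : X) :
    b.repr (basisProj b P x) μ = b.repr x μ := by
  have : b.coord μ ∘ₗ basisProj b P = b.coord μ := by
    refine b.ext fun ν => ?_
    by_cases hν : ν ∈ P
    · simp [basisProj_basis_of_mem b hν]
    · have : ν ≠ μ := fun h' => hν (h' ▸ h)
      simp [basisProj_basis_of_notMem b hν, this]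
  exact LinearMap.congr_fun this x

theorem basisProj_mem (P : Set κ) (x : X) : basisProj b P x ∈ basisSpan b P := by
  have : ∀ μ, basisProj b P (b μ) ∈ basisSpan b P := by
    intro μ
    by_cases h : μ ∈ P
    · rw [basisProj_basis_of_mem b h]
      exact basis_mem_basisSpan b h
    · rw [basisProj_basis_of_notMem b h]
      exact zero_mem _
  have h2 : (⊤ : Submodule K X) ≤ (basisSpan b P).comap (basisProj b P) := by
    rw [← b.span_eq, Submodule.span_le]
    rintro _ ⟨μ, rfl⟩
    exact this μ
  exact h2 trivial

theorem basisProj_eq_self {P : Set κ} {x : X} (h : x ∈ basisSpan b P) : basisProj b P x = x := by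
  refine b.ext_elem fun μ => ?_
  by_cases hμ : μ ∈ P
  · exact repr_basisProj_of_mem b hμ x
  · rw [(mem_basisSpan b).mp h μ hμ, (mem_basisSpan b).mp (basisProj_mem b P x) μ hμ]

theorem basisProj_eq_zero_iff {P : Set κ} {x : X} :
    basisProj b P x = 0 ↔ x ∈ basisSpan b Pᶜ := by
  rw [mem_basisSpan]
  constructor
  · intro h μ hμ
    rw [← repr_basisProj_of_mem b (Set.notMem_compl_iff.mp hμ), h]
    simp
  · intro h
    refine b.ext_elem fun μ => ?_
    rw [map_zero, Finsupp.zero_apply]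
    by_cases hμ : μ ∈ P
    · rw [repr_basisProj_of_mem b hμ]
      exact h μ (Set.notMem_compl_iff.mpr hμ)
    · exact (mem_basisSpan b).mp (basisProj_mem b P x) μ hμ

theorem basisProj_mem_of_mem (P : Set κ) {Q : Set κ} {x : X} (h : x ∈ basisSpan b Q) :
    basisProj b P x ∈ basisSpan b (P ∩ Q) := by
  refine basisSpan_le_comap b _ (fun μ hμ => ?_) h
  by_cases h' : μ ∈ P
  · rw [basisProj_basis_of_mem b h']
    exact basis_mem_basisSpan b ⟨h', hμ⟩
  · rw [basisProj_basis_of_notMem b h']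
    exact zero_mem _

end BasisSpan

/-! ### Monomials, contractions and the grading of the exterior algebra. -/

section Exterior

variable {K V : Type*} [Field K] [AddCommGroup V] [Module K V] {n : ℕ} (e : Basis (Fin n) K V)

/-- Left multiplication by a basis vector. -/
noncomputable def wedge (s : Fin n) : ExteriorAlgebra K V →ₗ[K] ExteriorAlgebra K V :=
  LinearMap.mulLeft K (ExteriorAlgebra.ι K (e s))

theorem wedge_apply (s : Fin n) (x : ExteriorAlgebra K V) :
    wedge e s x = ExteriorAlgebra.ι K (e s) * x := rfl

/-- Contraction with an element of the dual basis. -/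
noncomputable def contraction (t : Fin n) : ExteriorAlgebra K V →ₗ[K] ExteriorAlgebra K V :=
  CliffordAlgebra.contractLeft (e.coord t)

theorem wedge_anti (s t : Fin n) (x : ExteriorAlgebra K V) :
    wedge e s (wedge e t x) = -wedge e t (wedge e s x) := by
  simp only [wedge_apply, ← mul_assoc]
  rw [← neg_mul, eq_neg_of_add_eq_zero_left (ExteriorAlgebra.ι_add_mul_swap (e s) (e t))]

theorem wedge_sq (s : Fin n) (x : ExteriorAlgebra K V) : wedge e s (wedge e s x) = 0 := by
  simp only [wedge_apply, ← mul_assoc, ExteriorAlgebra.ι_sq_zero, zero_mul]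

theorem contraction_wedge (s t : Fin n) (x : ExteriorAlgebra K V) :
    contraction e t (wedge e s x) + wedge e s (contraction e t x) = if s = t then x else 0 := by
  rw [wedge_apply, wedge_apply, contraction]
  erw [CliffordAlgebra.contractLeft_ι_mul]
  rw [sub_add_cancel]
  simp [Finsupp.single_apply]

theorem contraction_anti (s t : Fin n) (x : ExteriorAlgebra K V) :
    contraction e s (contraction e t x) = -contraction e t (contraction e s x) :=
  CliffordAlgebra.contractLeft_comm _ _ _

theorem contraction_sq (s : Fin n) (x : ExteriorAlgebra K V) :
    contraction e s (contraction e s x) = 0 :=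
  CliffordAlgebra.contractLeft_contractLeft _ _

theorem contraction_one (t : Fin n) : contraction e t 1 = 0 :=
  CliffordAlgebra.contractLeft_one (Q := 0) (e.coord t)

theorem basis_empty : e.ExteriorAlgebra ∅ = 1 := by
  rw [ExteriorAlgebra.basis_apply_ofCard e (n := 0) Finset.card_empty]
  simp

theorem basis_singleton (s : Fin n) : e.ExteriorAlgebra {s} = ExteriorAlgebra.ι K (e s) := by
  rw [ExteriorAlgebra.basis_apply_ofCard e (n := 1) (Finset.card_singleton s)]
  rw [ExteriorAlgebra.ιMulti_family, ExteriorAlgebra.ιMulti_apply, List.ofFn_succ, List.ofFn_zero,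
    List.prod_singleton, Function.comp_apply]
  congr 2
  have := Set.powersetCard.mem_range_ofFinEmbEquiv_symm_iff_mem
    (Set.powersetCard.ofCard (Finset.card_singleton s)) 
      (Set.powersetCard.ofFinEmbEquiv.symm (Set.powersetCard.ofCard (Finset.card_singleton s)) 0)
  exact Finset.mem_singleton.mp (this.mp ⟨0, rfl⟩)

theorem basis_mul_basis_of_not_disjoint {μ ν : Finset (Fin n)} (h : ¬Disjoint μ ν) :
    e.ExteriorAlgebra μ * e.ExteriorAlgebra ν = 0 :=
  ExteriorAlgebra.basis_mul_of_not_disjoint e (Set.powersetCard.ofCard (rfl : μ.card = _))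
    (Set.powersetCard.ofCard (rfl : ν.card = _)) h

/-- The scalar is the sign of the permutation sorting the factors; later arguments need only that it
is nonzero. -/
theorem basis_mul_basis_of_disjoint {μ ν : Finset (Fin n)} (h : Disjoint μ ν) :
    ∃ c : K, c ≠ 0 ∧
      e.ExteriorAlgebra μ * e.ExteriorAlgebra ν = c • e.ExteriorAlgebra (μ ∪ ν) := by
  have := ExteriorAlgebra.basis_mul_of_disjoint e (Set.powersetCard.ofCard (rfl : μ.card = _))
    (Set.powersetCard.ofCard (rfl : ν.card = _)) h
  set u := (Set.powersetCard.permOfDisjoint (s := Set.powersetCard.ofCard (rfl : μ.card = _))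
    (t := Set.powersetCard.ofCard (rfl : ν.card = _)) h).sign
  refine ⟨(u : ℤ), ?_, ?_⟩
  · rcases Int.units_eq_one_or u with h' | h' <;> simp [h']
  · rw [Int.cast_smul_eq_zsmul, ← Finset.disjUnion_eq_union μ ν h]
    exact this

theorem wedge_basis_of_mem {s : Fin n} {μ : Finset (Fin n)} (h : s ∈ μ) :
    wedge e s (e.ExteriorAlgebra μ) = 0 := by
  rw [wedge_apply, ← basis_singleton, basis_mul_basis_of_not_disjoint]
  simpa using h

theorem wedge_basis_of_notMem {s : Fin n} {μ : Finset (Fin n)} (h : s ∉ μ) :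
    ∃ c : K, c ≠ 0 ∧ wedge e s (e.ExteriorAlgebra μ) = c • e.ExteriorAlgebra (insert s μ) := by
  rw [wedge_apply, ← basis_singleton, Finset.insert_eq]
  exact basis_mul_basis_of_disjoint e (by simpa using h)

theorem contraction_basis_of_notMem {t : Fin n} {μ : Finset (Fin n)} (h : t ∉ μ) :
    contraction e t (e.ExteriorAlgebra μ) = 0 := by
  induction μ using Finset.induction_on with
  | empty => rw [basis_empty, contraction_one]
  | insert s μ hs ih =>
    obtain ⟨c, hc, hc'⟩ := wedge_basis_of_notMem e hs
    rw [Finset.mem_insert, not_or] at h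
    have h1 := contraction_wedge e s t (e.ExteriorAlgebra μ)
    rw [ih h.2, map_zero, add_zero, if_neg (Ne.symm h.1), hc', map_smul] at h1
    exact (smul_eq_zero.mp h1).resolve_left hc

theorem contraction_basis_of_mem {t : Fin n} {μ : Finset (Fin n)} (h : t ∈ μ) :
    ∃ c : K, c ≠ 0 ∧ contraction e t (e.ExteriorAlgebra μ) = c • e.ExteriorAlgebra (μ.erase t) := by
  obtain ⟨c, hc, hc'⟩ := wedge_basis_of_notMem e (Finset.notMem_erase t μ)
  rw [Finset.insert_erase h] at hc'
  refine ⟨c⁻¹, inv_ne_zero hc, ?_⟩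
  have h1 := contraction_wedge e t t (e.ExteriorAlgebra (μ.erase t))
  rw [contraction_basis_of_notMem e (Finset.notMem_erase t μ), map_zero, add_zero, if_pos rfl, hc',
    map_smul] at h1
  rw [← h1, inv_smul_smul₀ hc]

theorem one_mem_exteriorPower_zero : (1 : ExteriorAlgebra K V) ∈ ⋀[K]^0 V :=
  SetLike.GradedOne.one_mem (A := fun i : ℕ => ⋀[K]^i V)

theorem basis_mem_exteriorPower (μ : Finset (Fin n)) :
    e.ExteriorAlgebra μ ∈ ⋀[K]^μ.card V := by
  have := ExteriorAlgebra.basis_eq_coe_basis e (Set.powersetCard.ofCard (rfl : μ.card = _))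
  exact this ▸ Subtype.coe_prop _

theorem wedge_mem_basisSpan {P Q : Set (Finset (Fin n))} {s : Fin n}
    (h : ∀ μ ∈ P, s ∉ μ → insert s μ ∈ Q) {x : ExteriorAlgebra K V}
    (hx : x ∈ basisSpan e.ExteriorAlgebra P) : wedge e s x ∈ basisSpan e.ExteriorAlgebra Q := by
  refine basisSpan_le_comap _ _ (fun μ hμ => ?_) hx
  by_cases hs : s ∈ μ
  · rw [wedge_basis_of_mem e hs]
    exact zero_mem _
  · obtain ⟨c, -, hc⟩ := wedge_basis_of_notMem e hs
    rw [hc]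
    exact Submodule.smul_mem _ _ (basis_mem_basisSpan _ (h μ hμ hs))

theorem contraction_mem_basisSpan {P Q : Set (Finset (Fin n))} {t : Fin n}
    (h : ∀ μ ∈ P, t ∈ μ → μ.erase t ∈ Q) {x : ExteriorAlgebra K V}
    (hx : x ∈ basisSpan e.ExteriorAlgebra P) :
    contraction e t x ∈ basisSpan e.ExteriorAlgebra Q := by
  refine basisSpan_le_comap _ _ (fun μ hμ => ?_) hx
  by_cases ht : t ∈ μ
  · obtain ⟨c, -, hc⟩ := contraction_basis_of_mem e ht
    rw [hc]
    exact Submodule.smul_mem _ _ (basis_mem_basisSpan _ (h μ hμ ht))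
  · rw [contraction_basis_of_notMem e ht]
    exact zero_mem _

theorem exteriorPower_eq_basisSpan (m : ℕ) :
    ⋀[K]^m V = basisSpan e.ExteriorAlgebra {μ | μ.card = m} := by
  apply le_antisymm
  · induction m with
    | zero =>
      intro x hx
      rw [ExteriorAlgebra.exteriorPower, pow_zero, Submodule.mem_one] at hx
      obtain ⟨c, rfl⟩ := hx
      rw [Algebra.algebraMap_eq_smul_one, ← basis_empty e]
      exact Submodule.smul_mem _ _ (basis_mem_basisSpan _ Finset.card_empty)
    | succ m ih =>
      rw [ExteriorAlgebra.exteriorPower, pow_succ', Submodule.mul_le]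
      rintro _ ⟨v, rfl⟩ x hx
      have hx' := ih hx
      rw [← e.sum_repr v, map_sum, Finset.sum_mul]
      refine Submodule.sum_mem _ fun s _ => ?_
      rw [map_smul, smul_mul_assoc]
      refine Submodule.smul_mem _ _ ?_
      refine wedge_mem_basisSpan e ?_ hx'
      rintro μ rfl hs
      exact Finset.card_insert_of_notMem hs
  · rw [basisSpan, Submodule.span_le]
    rintro _ ⟨μ, rfl, rfl⟩
    exact basis_mem_exteriorPower e μ

theorem homogeneousPart_eq_basisSpan (j : ℤ) :
    homogeneousPart K V j = basisSpan e.ExteriorAlgebra {μ | (μ.card : ℤ) = j} := by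
  unfold homogeneousPart
  split_ifs with h
  · rw [exteriorPower_eq_basisSpan e]
    congr 1
    ext μ
    simp only [Set.mem_ofPred_eq]
    lia
  · symm
    rw [eq_bot_iff, ← basisSpan_empty e.ExteriorAlgebra]
    refine basisSpan_mono _ fun μ hμ => ?_
    simp only [Set.mem_ofPred_eq] at hμ
    lia

theorem wedge_mem_homogeneousPart {s : Fin n} {j : ℤ} {x : ExteriorAlgebra K V}
    (hx : x ∈ homogeneousPart K V j) : wedge e s x ∈ homogeneousPart K V (j + 1) := by
  rw [homogeneousPart_eq_basisSpan e] at hx ⊢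
  refine wedge_mem_basisSpan e ?_ hx
  rintro μ rfl hs
  simp [Finset.card_insert_of_notMem hs]

theorem contraction_mem_homogeneousPart {t : Fin n} {j : ℤ} {x : ExteriorAlgebra K V}
    (hx : x ∈ homogeneousPart K V j) : contraction e t x ∈ homogeneousPart K V (j - 1) := by
  rw [homogeneousPart_eq_basisSpan e] at hx ⊢
  refine contraction_mem_basisSpan e ?_ hx
  rintro μ rfl hs
  simp only [Set.mem_ofPred_eq]
  rw [Finset.card_erase_of_mem hs, Nat.cast_pred (Finset.card_pos.mpr ⟨t, hs⟩)]

theorem mul_mem_homogeneousPart {i j : ℤ} {x y : ExteriorAlgebra K V}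
    (hx : x ∈ homogeneousPart K V i) (hy : y ∈ homogeneousPart K V j) :
    x * y ∈ homogeneousPart K V (i + j) := by
  unfold homogeneousPart at hx hy ⊢
  split_ifs at hx with hi
  · split_ifs at hy with hj
    · rw [if_pos (add_nonneg hi hj), Int.toNat_add hi hj]
      exact SetLike.mul_mem_graded (A := fun i : ℕ => ⋀[K]^i V) hx hy
    · rw [(Submodule.mem_bot K).mp hy, mul_zero]
      exact zero_mem _
  · rw [(Submodule.mem_bot K).mp hx, zero_mul]
    exact zero_mem _

/-- The projection of the exterior algebra onto its component of degree `j`. -/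
noncomputable def degreeProj (j : ℤ) : ExteriorAlgebra K V →ₗ[K] ExteriorAlgebra K V :=
  basisProj e.ExteriorAlgebra {μ | (μ.card : ℤ) = j}

theorem degreeProj_mem (j : ℤ) (x : ExteriorAlgebra K V) :
    degreeProj e j x ∈ homogeneousPart K V j := by
  rw [homogeneousPart_eq_basisSpan e]
  exact basisProj_mem _ _ _

theorem degreeProj_eq_self {j : ℤ} {x : ExteriorAlgebra K V} (h : x ∈ homogeneousPart K V j) :
    degreeProj e j x = x := by
  rw [homogeneousPart_eq_basisSpan e] at h
  exact basisProj_eq_self _ h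

theorem degreeProj_eq_zero {i j : ℤ} (hij : i ≠ j) {x : ExteriorAlgebra K V}
    (h : x ∈ homogeneousPart K V i) : degreeProj e j x = 0 := by
  rw [homogeneousPart_eq_basisSpan e] at h
  refine (basisProj_eq_zero_iff _).mpr (basisSpan_mono _ (fun μ hμ => ?_) h)
  simp only [Set.mem_ofPred_eq, Set.mem_compl_iff] at hμ ⊢
  lia

theorem basis_mem_homogeneousPart (μ : Finset (Fin n)) :
    e.ExteriorAlgebra μ ∈ homogeneousPart K V μ.card := by
  rw [homogeneousPart_eq_basisSpan e]
  exact basis_mem_basisSpan _ rfl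

/-- Maps of free left modules act by right multiplication with their matrix entries; this is why
homogeneous maps commute with the projections onto graded pieces. -/
theorem degreeProj_mul (i : ℤ) {j : ℤ} {y : ExteriorAlgebra K V}
    (hy : y ∈ homogeneousPart K V j) (x : ExteriorAlgebra K V) :
    degreeProj e (i + j) (x * y) = degreeProj e i x * y := by
  have : degreeProj e (i + j) ∘ₗ LinearMap.mulRight K y =
      LinearMap.mulRight K y ∘ₗ degreeProj e i := by
    refine e.ExteriorAlgebra.ext fun μ => ?_
    have hμ := basis_mem_homogeneousPart e μ
    simp only [LinearMap.comp_apply, LinearMap.mulRight_apply]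
    by_cases h : (μ.card : ℤ) = i
    · subst h
      rw [degreeProj_eq_self e (mul_mem_homogeneousPart hμ hy), degreeProj_eq_self e hμ]
    · rw [degreeProj_eq_zero e _ (mul_mem_homogeneousPart hμ hy), degreeProj_eq_zero e h hμ,
        zero_mul]
      lia
  exact LinearMap.congr_fun this x

theorem sum_degreeProj {J : Finset ℤ} {d : ℤ} (hJ : ∀ μ : Finset (Fin n), (μ.card : ℤ) + d ∈ J)
    (x : ExteriorAlgebra K V) : ∑ j ∈ J, degreeProj e (j - d) x = x := by
  have : ∑ j ∈ J, degreeProj e (j - d) = LinearMap.id := by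
    refine e.ExteriorAlgebra.ext fun μ => ?_
    rw [LinearMap.sum_apply, LinearMap.id_apply, Finset.sum_eq_single (μ.card + d)]
    · rw [add_sub_cancel_right]
      exact degreeProj_eq_self e (basis_mem_homogeneousPart e μ)
    · intro j _ hj
      refine degreeProj_eq_zero e ?_ (basis_mem_homogeneousPart e μ)
      lia
    · exact fun h => absurd (hJ μ) h
  rw [← LinearMap.sum_apply, this, LinearMap.id_apply]

/-- If contraction with `t` kills `x`, the Leibniz rule writes `x` as the contraction of `e_t ∧ x`,
and a contraction with `t` involves no monomial containing `t`. -/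
theorem mem_basisSpan_disjoint {T : Finset (Fin n)} {x : ExteriorAlgebra K V}
    (h : ∀ t ∈ T, contraction e t x = 0) :
    x ∈ basisSpan e.ExteriorAlgebra {μ | Disjoint μ T} := by
  rw [mem_basisSpan]
  intro μ hμ
  rw [Set.mem_ofPred_eq, Finset.not_disjoint_iff] at hμ
  obtain ⟨t, htμ, ht⟩ := hμ
  have h1 := contraction_wedge e t t x
  rw [h t ht, map_zero, add_zero, if_pos rfl] at h1
  have h2 : contraction e t (wedge e t x) ∈ basisSpan e.ExteriorAlgebra {μ | t ∉ μ} :=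
    contraction_mem_basisSpan e (P := Set.univ) (fun ν _ _ => Finset.notMem_erase t ν)
      ((mem_basisSpan _).mpr fun ν hν => absurd trivial hν)
  rw [h1] at h2
  exact (mem_basisSpan _).mp h2 μ (not_not.mpr htμ)

end Exterior
end ExtBetti

/-! ### Combinatorics of monomial ideals with linear quotients. -/

namespace ExtBetti

open Module

section LinearQuotients

variable {K V : Type*} [Field K] [AddCommGroup V] [Module K V] {n : ℕ} (e : Basis (Fin n) K V)

/-- The supports of the monomials divisible by one of the monomials in `G`. -/
def multiples (G : Set (Finset (Fin n))) : Set (Finset (Fin n)) :=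
  {μ | ∃ ν ∈ G, ν ⊆ μ}

theorem mul_mem_basisSpan_multiples {G : Set (Finset (Fin n))} (x : ExteriorAlgebra K V)
    {y : ExteriorAlgebra K V} (hy : y ∈ basisSpan e.ExteriorAlgebra (multiples G)) :
    x * y ∈ basisSpan e.ExteriorAlgebra (multiples G) := by
  refine basisSpan_le_comap _ (LinearMap.mulLeft K x) (fun μ hμ => ?_) hy
  refine basisSpan_le_comap e.ExteriorAlgebra (P := Set.univ)
    (LinearMap.mulRight K (e.ExteriorAlgebra μ)) (fun ν _ => ?_)
    ((mem_basisSpan _).mpr fun ν hν => absurd trivial hν)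
  rw [LinearMap.mulRight_apply]
  by_cases h : Disjoint ν μ
  · obtain ⟨c, -, hc⟩ := basis_mul_basis_of_disjoint e h
    rw [hc]
    obtain ⟨ξ, hξ, hξμ⟩ := hμ
    exact Submodule.smul_mem _ _ (basis_mem_basisSpan _
      ⟨ξ, hξ, hξμ.trans Finset.subset_union_right⟩)
  · rw [basis_mul_basis_of_not_disjoint e h]
    exact zero_mem _

/-- The span of the multiples is already a left ideal, and a multiple of `e_ν` is, up to a nonzero
scalar, a left multiple of it. Ideal membership thus becomes a question about inclusions of
supports. -/
theorem mem_monomialIdeal_iff {G : Set (Finset (Fin n))} {x : ExteriorAlgebra K V} :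
    x ∈ monomialIdeal e G ↔ x ∈ basisSpan e.ExteriorAlgebra (multiples G) := by
  constructor
  · intro hx
    let J : Ideal (ExteriorAlgebra K V) :=
      { (basisSpan e.ExteriorAlgebra (multiples G)).toAddSubmonoid with
        smul_mem' := fun x _ hy => mul_mem_basisSpan_multiples e x hy }
    have : monomialIdeal e G ≤ J := by
      refine Ideal.span_le.mpr ?_
      rintro _ ⟨μ, hμ, rfl⟩
      exact basis_mem_basisSpan e.ExteriorAlgebra ⟨μ, hμ, subset_rfl⟩
    exact this hx
  · intro hx
    have : basisSpan e.ExteriorAlgebra (multiples G) ≤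
        (monomialIdeal e G).restrictScalars K := by
      refine Submodule.span_le.mpr ?_
      rintro _ ⟨μ, ⟨ν, hν, hνμ⟩, rfl⟩
      obtain ⟨c, hc, hc'⟩ := basis_mul_basis_of_disjoint e
        (Finset.sdiff_disjoint : Disjoint (μ \ ν) ν)
      rw [Finset.sdiff_union_of_subset hνμ] at hc'
      have h1 : e.ExteriorAlgebra μ = c⁻¹ • (e.ExteriorAlgebra (μ \ ν) * e.ExteriorAlgebra ν) := by
        rw [hc', inv_smul_smul₀ hc]
      rw [h1]
      refine Submodule.smul_mem _ _ ?_
      exact Ideal.mul_mem_left _ _ (Ideal.subset_span ⟨ν, hν, rfl⟩)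
    exact this hx

theorem basis_mem_monomialIdeal_iff {G : Set (Finset (Fin n))} {μ : Finset (Fin n)} :
    e.ExteriorAlgebra μ ∈ monomialIdeal e G ↔ ∃ ν ∈ G, ν ⊆ μ := by
  rw [mem_monomialIdeal_iff, basis_mem_basisSpan_iff]
  rfl

theorem monomialIdeal_eq_of_multiples_eq {G G' : Set (Finset (Fin n))}
    (h : multiples G = multiples G') : monomialIdeal e G = monomialIdeal e G' := by
  ext x
  rw [mem_monomialIdeal_iff, mem_monomialIdeal_iff, h]

theorem span_ι_eq_monomialIdeal (S : Set (Fin n)) :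
    Ideal.span ((fun s => ExteriorAlgebra.ι K (e s)) '' S) = monomialIdeal e (singleton '' S) := by
  rw [monomialIdeal, Set.image_image]
  simp_rw [basis_singleton]

variable {e} {I : Ideal (ExteriorAlgebra K V)} {r : ℕ} {u : Fin r → Finset (Fin n)}

theorem HasLinearQuotients.mem_iff (hu : HasLinearQuotients e I u) {x : ExteriorAlgebra K V} :
    x ∈ I ↔ x ∈ basisSpan e.ExteriorAlgebra (multiples (Set.range u)) := by
  rw [← mem_monomialIdeal_iff, hu.generators.prop]

theorem HasLinearQuotients.eq_of_subset (hu : HasLinearQuotients e I u) {k l : Fin r}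
    (h : u k ⊆ u l) : k = l := by
  by_contra hkl
  have h1 : monomialIdeal e (Set.range u \ {u l}) = I := by
    rw [← hu.generators.prop]
    refine monomialIdeal_eq_of_multiples_eq e (Set.Subset.antisymm ?_ ?_)
    · rintro μ ⟨ν, hν, hνμ⟩
      exact ⟨ν, hν.1, hνμ⟩
    · rintro μ ⟨_, ⟨m, rfl⟩, hm⟩
      by_cases hml : m = l
      · subst hml
        exact ⟨u k, ⟨⟨k, rfl⟩, fun h' => hkl (hu.injective h')⟩, h.trans hm⟩
      · exact ⟨u m, ⟨⟨m, rfl⟩, fun h' => hml (hu.injective h')⟩, hm⟩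
  exact (hu.generators.le_of_le h1 Set.sdiff_subset ⟨l, rfl⟩).2 rfl

theorem HasLinearQuotients.nonempty (hu : HasLinearQuotients e I u) (hI : I ≠ ⊤) (k : Fin r) :
    (u k).Nonempty := by
  rw [Finset.nonempty_iff_ne_empty]
  intro h
  refine hI ((Ideal.eq_top_iff_one I).mpr ?_)
  rw [← basis_empty e, ← hu.generators.prop, basis_mem_monomialIdeal_iff]
  exact ⟨u k, ⟨k, rfl⟩, h.le⟩

theorem mem_linSet_iff {k : Fin r} {s : Fin n} :
    s ∈ linSet e u k ↔ ExteriorAlgebra.ι K (e s) ∈ colonIdeal e u k := by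
  simp [linSet]

theorem mem_linSet {k : Fin r} {s : Fin n} :
    s ∈ linSet e u k ↔ s ∈ u k ∨ ∃ l < k, u l ⊆ insert s (u k) := by
  rw [mem_linSet_iff, colonIdeal, Submodule.mem_colon_singleton, smul_eq_mul,
    ← wedge_apply]
  by_cases h : s ∈ u k
  · simp [wedge_basis_of_mem e h, h]
  · obtain ⟨c, hc, hc'⟩ := wedge_basis_of_notMem e h
    rw [hc']
    have : c • e.ExteriorAlgebra (insert s (u k)) ∈ monomialIdeal e (u '' Set.Iio k) ↔
        e.ExteriorAlgebra (insert s (u k)) ∈ monomialIdeal e (u '' Set.Iio k) := by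
      rw [mem_monomialIdeal_iff, mem_monomialIdeal_iff, Submodule.smul_mem_iff _ hc]
    rw [this, basis_mem_monomialIdeal_iff]
    simp [h]

/-- Because `e_s` annihilates a monomial containing it. For a proper ideal this makes `set(u_k)`
nonempty. -/
theorem subset_linSet (e : Basis (Fin n) K V) (u : Fin r → Finset (Fin n)) (k : Fin r) :
    u k ⊆ linSet e u k :=
  fun _ hs => mem_linSet.mpr (Or.inl hs)

/-- Linear quotients in combinatorial form. The monomial on `μ \ u k` lies in the colon ideal, which
is generated by variables, so one of these variables divides it. -/
theorem HasLinearQuotients.exists_lt_subset_iff (hu : HasLinearQuotients e I u) {k : Fin r}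
    {μ : Finset (Fin n)} (hμ : u k ⊆ μ) :
    (∃ l < k, u l ⊆ μ) ↔ ∃ s ∈ linSet e u k, s ∈ μ ∧ s ∉ u k := by
  constructor
  · rintro ⟨l, hl, hlμ⟩
    obtain ⟨S, hS⟩ := hu.colon_linear k
    rw [span_ι_eq_monomialIdeal] at hS
    have h1 : e.ExteriorAlgebra (μ \ u k) ∈ colonIdeal e u k := by
      rw [colonIdeal, Submodule.mem_colon_singleton, smul_eq_mul]
      obtain ⟨c, hc, hc'⟩ := basis_mul_basis_of_disjoint e
        (Finset.sdiff_disjoint : Disjoint (μ \ u k) (u k))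
      rw [hc', Finset.sdiff_union_of_subset hμ, mem_monomialIdeal_iff]
      exact Submodule.smul_mem _ _ (basis_mem_basisSpan _ ⟨u l, ⟨l, hl, rfl⟩, hlμ⟩)
    rw [hS, basis_mem_monomialIdeal_iff] at h1
    obtain ⟨_, ⟨s, hs, rfl⟩, hsμ⟩ := h1
    have hs' := Finset.mem_sdiff.mp (Finset.singleton_subset_iff.mp hsμ)
    refine ⟨s, ?_, hs'⟩
    rw [mem_linSet_iff, hS, ← basis_singleton, basis_mem_monomialIdeal_iff]
    exact ⟨{s}, ⟨s, hs, rfl⟩, subset_rfl⟩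
  · rintro ⟨s, hs, hsμ, hsk⟩
    obtain ⟨l, hl, hlk⟩ := (mem_linSet.mp hs).resolve_left hsk
    exact ⟨l, hl, hlk.trans (Finset.insert_subset hsμ hμ)⟩

/-- The key of a generator in the ordering by degree, refined by the given ordering. -/
def degreeKey (u : Fin r → Finset (Fin n)) (k : Fin r) : ℕ ×ₗ Fin r :=
  toLex ((u k).card, k)

theorem degreeKey_lt_iff {k l : Fin r} : degreeKey u l < degreeKey u k ↔
    (u l).card < (u k).card ∨ (u l).card = (u k).card ∧ l < k := by
  simp [degreeKey, Prod.Lex.toLex_lt_toLex]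

/-- Otherwise `u l` would equal `insert s (u k)` and so contain the minimal generator `u k`. -/
theorem HasLinearQuotients.card_le (hu : HasLinearQuotients e I u) {k l : Fin r} {s : Fin n}
    (hkl : l ≠ k) (h : u l ⊆ insert s (u k)) : (u l).card ≤ (u k).card := by
  by_contra h'
  have h1 := Finset.eq_of_subset_of_card_le h
    ((Finset.card_insert_le s (u k)).trans (Nat.succ_le_of_lt (not_le.mp h')))
  exact hkl (hu.eq_of_subset (k := k) (l := l) (h1 ▸ Finset.subset_insert s (u k))).symm

/-- Sorting the generators by degree preserves linear quotients and the sets `linSet`. -/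
theorem HasLinearQuotients.exists_degreeKey_lt_subset_iff (hu : HasLinearQuotients e I u)
    {k : Fin r} {μ : Finset (Fin n)} (hμ : u k ⊆ μ) :
    (∃ l, degreeKey u l < degreeKey u k ∧ u l ⊆ μ) ↔ ∃ s ∈ linSet e u k, s ∈ μ ∧ s ∉ u k := by
  constructor
  · rintro ⟨l, hl, hlμ⟩
    rw [← hu.exists_lt_subset_iff hμ]
    rw [degreeKey_lt_iff] at hl
    rcases hl with hl | hl
    · induction l using WellFoundedLT.induction with
      | ind l ih =>
        rcases lt_trichotomy l k with hlk | rfl | hlk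
        · exact ⟨l, hlk, hlμ⟩
        · exact absurd hl (lt_irrefl _)
        -- Here `l` comes after `k` but has smaller degree. Linear quotients at `l`, applied to the
        -- multiple `u k ∪ u l`, give an index `m < l` with `u m ⊆ μ` and degree at most that of `u
        -- l`. The descent passes below `k`, and cannot stop at `k` itself because the degree stays
        -- smaller.
        · obtain ⟨s, hs, hsk, hsl⟩ := (hu.exists_lt_subset_iff
            (Finset.subset_union_right (s₁ := u k) (s₂ := u l))).mp
            ⟨k, hlk, Finset.subset_union_left⟩
          obtain ⟨m, hm, hms⟩ := (mem_linSet.mp hs).resolve_left hsl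
          have hsk' : s ∈ u k := (Finset.mem_union.mp hsk).resolve_right hsl
          exact ih m hm (hms.trans (Finset.insert_subset (hμ hsk') hlμ))
            ((hu.card_le hm.ne hms).trans_lt hl)
    · exact ⟨l, hl.2, hlμ⟩
  · rintro ⟨s, hs, hsμ, hsk⟩
    obtain ⟨l, hl, hlk⟩ := (mem_linSet.mp hs).resolve_left hsk
    refine ⟨l, ?_, hlk.trans (Finset.insert_subset hsμ hμ)⟩
    rw [degreeKey_lt_iff]
    rcases (hu.card_le hl.ne hlk).lt_or_eq with h | h
    · exact Or.inl h
    · exact Or.inr ⟨h, hl⟩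

end LinearQuotients
end ExtBetti

/-! ### Cartan homology of an ideal with linear quotients. -/

namespace ExtBetti

open Module

section MonomialHomology

variable {K V : Type*} [Field K] [AddCommGroup V] [Module K V] {n : ℕ} (e : Basis (Fin n) K V)

theorem finiteDimensional_exteriorAlgebra (e : Basis (Fin n) K V) :
    FiniteDimensional K (ExteriorAlgebra K V) :=
  Module.Finite.of_basis e.ExteriorAlgebra

/-- The homogeneous elements of degree `j` in the span of the monomials with support in `P`. -/
noncomputable def gradedSpan (P : Set (Finset (Fin n))) (j : ℤ) : Submodule K (ExteriorAlgebra K V) :=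
  basisSpan e.ExteriorAlgebra (P ∩ {μ | (μ.card : ℤ) = j})

theorem gradedSpan_eq (P : Set (Finset (Fin n))) (j : ℤ) :
    gradedSpan e P j = basisSpan e.ExteriorAlgebra P ⊓ homogeneousPart K V j := by
  rw [homogeneousPart_eq_basisSpan e, basisSpan_inf, gradedSpan]

theorem isExteriorAction_gradedSpan {P : Set (Finset (Fin n))} (hP : IsUpperSet P) :
    IsExteriorAction (wedge e) (gradedSpan e P) where
  anti := wedge_anti e
  sq := wedge_sq e
  mem s j x hx := by
    refine wedge_mem_basisSpan e ?_ hx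
    rintro μ ⟨hμ, rfl⟩ hs
    refine ⟨hP (Finset.subset_insert s μ) hμ, ?_⟩
    simp [Finset.card_insert_of_notMem hs]

theorem isUpperSet_multiples (G : Set (Finset (Fin n))) : IsUpperSet (multiples G) :=
  fun _ _ h ⟨ξ, hξ, hξμ⟩ => ⟨ξ, hξ, hξμ.trans h⟩

/-- Left multiplication by the basis vectors in `T`; the other basis vectors act as zero. -/
noncomputable def wedgeOn (T : Finset (Fin n)) (s : Fin n) :
    ExteriorAlgebra K V →ₗ[K] ExteriorAlgebra K V :=
  if s ∈ T then wedge e s else 0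

theorem wedgeOn_of_mem {T : Finset (Fin n)} {s : Fin n} (h : s ∈ T) :
    wedgeOn e T s = wedge e s := if_pos h

theorem wedgeOn_of_notMem {T : Finset (Fin n)} {s : Fin n} (h : s ∉ T) :
    wedgeOn e T s = 0 := if_neg h

/-- The interval spans a copy of the exterior algebra on `T`, shifted by `ν`. Disjointness ensures
that contraction with `t ∈ T` never removes an element of `ν`. -/
theorem hasContractions_wedgeOn {ν T : Finset (Fin n)} (hν : Disjoint ν T) :
    HasContractions (wedgeOn e T) (contraction e) T
      (gradedSpan e (Set.Icc ν (ν ∪ T))) where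
  anti s t x := by
    by_cases hs : s ∈ T
    · by_cases ht : t ∈ T
      · rw [wedgeOn_of_mem e hs, wedgeOn_of_mem e ht, wedge_anti]
      · simp [wedgeOn_of_notMem e ht]
    · simp [wedgeOn_of_notMem e hs]
  sq s x := by
    by_cases hs : s ∈ T
    · rw [wedgeOn_of_mem e hs, wedge_sq]
    · simp [wedgeOn_of_notMem e hs]
  mem s j x hx := by
    by_cases hs : s ∈ T
    · rw [wedgeOn_of_mem e hs]
      refine wedge_mem_basisSpan e ?_ hx
      rintro μ ⟨hμ, rfl⟩ hsμ
      refine ⟨⟨hμ.1.trans (Finset.subset_insert s μ),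
        Finset.insert_subset (Finset.mem_union_right _ hs) hμ.2⟩, ?_⟩
      simp [Finset.card_insert_of_notMem hsμ]
    · rw [wedgeOn_of_notMem e hs]
      exact zero_mem _
  eq_zero s hs := wedgeOn_of_notMem e hs
  contract s t ht x := by
    by_cases hs : s ∈ T
    · rw [wedgeOn_of_mem e hs, contraction_wedge]
    · have : s ≠ t := fun h => hs (h ▸ ht)
      simp [wedgeOn_of_notMem e hs, this]
  contract_anti := contraction_anti e
  contract_sq := contraction_sq e
  contract_mem t ht j x hx := by
    refine contraction_mem_basisSpan e ?_ hx
    rintro μ ⟨hμ, rfl⟩ htμ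
    refine ⟨⟨?_, (Finset.erase_subset t μ).trans hμ.2⟩, ?_⟩
    · exact Finset.subset_erase.mpr ⟨hμ.1, Finset.disjoint_right.mp hν ht⟩
    · simp only [Set.mem_ofPred_eq]
      rw [Finset.card_erase_of_mem htμ, Nat.cast_pred (Finset.card_pos.mpr ⟨t, htμ⟩)]

theorem primitives_gradedSpan {ν T : Finset (Fin n)} (hν : Disjoint ν T) (j : ℤ) :
    primitives (contraction e) T (gradedSpan e (Set.Icc ν (ν ∪ T))) j =
      basisSpan e.ExteriorAlgebra ({ν} ∩ {μ | (μ.card : ℤ) = j}) := by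
  apply le_antisymm
  · rintro x ⟨hx, hx'⟩
    have h1 := mem_basisSpan_disjoint e (T := T) (x := x) fun t ht => by
      simp only [SetLike.mem_coe, Submodule.mem_iInf] at hx'
      exact hx' t ht
    have h2 := (basisSpan_inf _ _ _).le ⟨hx, h1⟩
    refine basisSpan_mono _ ?_ h2
    rintro μ ⟨⟨hμ, hμ'⟩, hμT⟩
    exact ⟨le_antisymm (fun a ha => (Finset.mem_union.mp (hμ.2 ha)).resolve_right
      (Finset.disjoint_left.mp hμT ha)) hμ.1, hμ'⟩
  · refine Submodule.span_le.mpr ?_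
    rintro _ ⟨μ, ⟨rfl, hμ⟩, rfl⟩
    refine ⟨basis_mem_basisSpan _ ⟨⟨le_rfl, Finset.subset_union_left⟩, hμ⟩, ?_⟩
    simp only [SetLike.mem_coe, Submodule.mem_iInf]
    exact fun t ht => contraction_basis_of_notMem e (Finset.disjoint_right.mp hν ht)

theorem cartanDim_wedgeOn {ν T : Finset (Fin n)} (hν : Disjoint ν T) (p : ℕ) (q : ℤ) :
    cartanDim (wedgeOn e T) (gradedSpan e (Set.Icc ν (ν ∪ T))) p q =
      if (ν.card : ℤ) = q - p then Tᶜ.card.multichoose p else 0 := by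
  have := finiteDimensional_exteriorAlgebra e
  rw [(hasContractions_wedgeOn e hν).cartanDim_eq, primitives_gradedSpan e hν]
  split_ifs with h
  · have : ({ν} ∩ {μ | (μ.card : ℤ) = q - p} : Set (Finset (Fin n))) = {ν} :=
      Set.inter_eq_left.mpr (by simpa using h)
    rw [this, basisSpan, Set.image_singleton, finrank_span_singleton (e.ExteriorAlgebra.ne_zero ν),
      mul_one]
  · have : ({ν} ∩ {μ | (μ.card : ℤ) = q - p} : Set (Finset (Fin n))) = ∅ := by
      rw [Set.singleton_inter_eq_empty]
      exact h
    rw [this, basisSpan_empty, finrank_bot, mul_zero]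

/-- The coordinate projection models the quotient by the span of `P'`. A variable outside `T` sends
a monomial of the interval to zero or out of the interval, so it acts as zero on the quotient. -/
theorem isGradedQuotient_gradedSpan {P P' : Set (Finset (Fin n))} (hP : IsUpperSet P)
    (hP' : IsUpperSet P') (hle : P' ⊆ P) {ν T : Finset (Fin n)} (hν : Disjoint ν T)
    (hdiff : P \ P' = Set.Icc ν (ν ∪ T)) :
    IsGradedQuotient (wedge e) (wedgeOn e T) (gradedSpan e P') (gradedSpan e P)
      (gradedSpan e (Set.Icc ν (ν ∪ T)))
      (basisProj e.ExteriorAlgebra (Set.Icc ν (ν ∪ T))) where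
  left := isExteriorAction_gradedSpan e hP'
  middle := isExteriorAction_gradedSpan e hP
  right := (hasContractions_wedgeOn e hν).toIsExteriorAction
  comm s j x hx := by
    set R := Set.Icc ν (ν ∪ T) with hR
    -- Membership in `⊥` expresses the vanishing of the commutator in a form that can be checked on
    -- the monomials in `P`.
    have : (basisProj e.ExteriorAlgebra R ∘ₗ wedge e s -
        wedgeOn e T s ∘ₗ basisProj e.ExteriorAlgebra R) x ∈ (⊥ : Submodule K _) := by
      refine basisSpan_le_comap e.ExteriorAlgebra _ (fun μ hμ => ?_) hx
      rw [Submodule.mem_bot, LinearMap.sub_apply, LinearMap.comp_apply, LinearMap.comp_apply]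
      by_cases hμR : μ ∈ R
      · rw [basisProj_basis_of_mem _ hμR]
        by_cases hs : s ∈ μ
        · rw [wedge_basis_of_mem e hs, map_zero, zero_sub, neg_eq_zero, wedgeOn]
          split_ifs
          · exact wedge_basis_of_mem e hs
          · rfl
        · obtain ⟨c, -, hc⟩ := wedge_basis_of_notMem e hs
          by_cases hsT : s ∈ T
          · have : insert s μ ∈ R := ⟨hμR.1.trans (Finset.subset_insert s μ),
              Finset.insert_subset (Finset.mem_union_right _ hsT) hμR.2⟩
            rw [wedgeOn_of_mem e hsT, hc, map_smul, basisProj_basis_of_mem _ this, sub_self]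
          · have : insert s μ ∉ R := by
              intro h
              rcases Finset.mem_union.mp (h.2 (Finset.mem_insert_self s μ)) with h' | h'
              · exact hs (hμR.1 h')
              · exact hsT h'
            rw [wedgeOn_of_notMem e hsT, hc, map_smul, basisProj_basis_of_notMem _ this, smul_zero,
              LinearMap.zero_apply, sub_zero]
      · rw [basisProj_basis_of_notMem _ hμR, map_zero, sub_zero, basisProj_eq_zero_iff]
        have hμ' : μ ∈ P' := by
          by_contra h
          exact hμR (hdiff ▸ ⟨hμ.1, h⟩)
        refine wedge_mem_basisSpan e (P := P') (fun ξ hξ _ => ?_) (basis_mem_basisSpan _ hμ')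
        rw [← hdiff]
        exact fun h => h.2 (hP' (Finset.subset_insert s ξ) hξ)
    exact sub_eq_zero.mp this
  ker j := by
    ext x
    rw [Submodule.mem_inf, LinearMap.mem_ker, basisProj_eq_zero_iff, ← Submodule.mem_inf,
      gradedSpan, basisSpan_inf, gradedSpan, ← hdiff]
    have : P ∩ {μ | (μ.card : ℤ) = j} ∩ (P \ P')ᶜ = P' ∩ {μ | (μ.card : ℤ) = j} := by
      ext μ
      have := @hle μ
      simp only [Set.mem_inter_iff, Set.mem_compl_iff, Set.mem_sdiff]
      tauto
    rw [this]
  map j := by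
    apply le_antisymm
    · rintro _ ⟨x, hx, rfl⟩
      refine basisSpan_mono _ ?_ (basisProj_mem_of_mem _ _ hx)
      rintro μ ⟨h1, -, h2⟩
      exact ⟨h1, h2⟩
    · intro x hx
      have h1 : Set.Icc ν (ν ∪ T) ∩ {μ | (μ.card : ℤ) = j} ⊆ P ∩ {μ | (μ.card : ℤ) = j} :=
        Set.inter_subset_inter_left _ (hdiff ▸ Set.sdiff_subset)
      exact ⟨x, basisSpan_mono _ h1 hx,
        basisProj_eq_self _ (basisSpan_mono _ Set.inter_subset_left hx)⟩

variable {e} {I : Ideal (ExteriorAlgebra K V)} {r : ℕ} {u : Fin r → Finset (Fin n)}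

/-- A multiple of `u k` is new exactly if it contains no element of `set(u_k)` beyond `u k` itself,
by linear quotients for the order by degree. -/
theorem HasLinearQuotients.multiples_sdiff (hu : HasLinearQuotients e I u) {k : Fin r}
    {A : Finset (Fin r)} (hk : k ∉ A) (hA : ∀ l, degreeKey u l < degreeKey u k ↔ l ∈ A) :
    multiples (u '' (insert k A : Finset (Fin r))) \ multiples (u '' A) =
      Set.Icc (u k) (u k ∪ (linSet e u k)ᶜ) := by
  ext μ
  have key : ∀ {μ}, u k ⊆ μ → (μ ∈ multiples (u '' A) ↔ ∃ s ∈ linSet e u k, s ∈ μ ∧ s ∉ u k) := by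
    intro μ hμ
    rw [← hu.exists_degreeKey_lt_subset_iff hμ]
    simp [multiples, hA]
  constructor
  · rintro ⟨⟨_, ⟨l, hl, rfl⟩, hlμ⟩, h2⟩
    have hlk : l = k := by
      refine (Finset.mem_insert.mp hl).resolve_right fun hl' => h2 ⟨_, ⟨l, hl', rfl⟩, hlμ⟩
    subst hlk
    refine ⟨hlμ, fun s hs => ?_⟩
    rw [key hlμ] at h2
    rw [Finset.mem_union, Finset.mem_compl]
    by_contra h3
    push Not at h3
    exact h2 ⟨s, h3.2, hs, h3.1⟩
  · rintro ⟨h1, h2⟩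
    refine ⟨⟨_, ⟨k, Finset.mem_insert_self k A, rfl⟩, h1⟩, ?_⟩
    rw [key h1]
    rintro ⟨s, hs, hsμ, hsk⟩
    exact Finset.mem_compl.mp ((Finset.mem_union.mp (h2 hsμ)).resolve_left hsk) hs

/-- Induction over initial segments of the order by degree, removing the generator with the largest
key; the homology of each successive quotient is known and splits off. -/
theorem HasLinearQuotients.cartanDim_multiples (hu : HasLinearQuotients e I u) (A : Finset (Fin r))
    (hA : ∀ k ∈ A, ∀ l, degreeKey u l < degreeKey u k → l ∈ A) (p : ℕ) (q : ℤ) :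
    cartanDim (wedge e) (gradedSpan e (multiples (u '' A))) p q =
      ∑ k ∈ A, if ((u k).card : ℤ) = q - p then (linSet e u k).card.multichoose p else 0 := by
  have := finiteDimensional_exteriorAlgebra e
  induction A using Finset.induction_on_max_value (degreeKey u) generalizing p with
  | empty =>
    have : gradedSpan e (multiples (u '' (∅ : Finset (Fin r)))) = fun _ => ⊥ := by
      funext j
      rw [eq_bot_iff, ← basisSpan_empty e.ExteriorAlgebra]
      refine basisSpan_mono _ ?_
      rintro μ ⟨⟨ν, hν, -⟩, -⟩
      simp at hν
    rw [Finset.sum_empty, this]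
    have hc : cycles (wedge e) (fun _ => (⊥ : Submodule K (ExteriorAlgebra K V))) p q = ⊥ := by
      rw [eq_bot_iff]
      refine (cycles_le_chains _ _ _ _).trans fun f hf => ?_
      rw [Submodule.mem_bot]
      funext a
      exact (Submodule.mem_bot K).mp (mem_chains.mp hf a)
    rw [cartanDim, hc, finrank_bot, Nat.zero_sub]
  | insert k A hk hmax ih =>
    have hlt : ∀ l, degreeKey u l < degreeKey u k ↔ l ∈ A := by
      intro l
      constructor
      · intro h
        refine (Finset.mem_insert.mp (hA k (Finset.mem_insert_self k A) l h)).resolve_left ?_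
        rintro rfl
        exact lt_irrefl _ h
      · intro h
        refine lt_of_le_of_ne (hmax l h) fun h' => hk ?_
        have : l = k := (Prod.ext_iff.mp (toLex.injective h')).2
        exact this ▸ h
    have ih' := ih fun l hl m hm => (hlt m).mp (hm.trans_le (hmax l hl))
    have hd : Disjoint (u k) (linSet e u k)ᶜ :=
      disjoint_compl_right.mono_left (subset_linSet e u k)
    have hq := isGradedQuotient_gradedSpan e (isUpperSet_multiples _) (isUpperSet_multiples _)
      (fun μ ⟨ν, hν, hνμ⟩ => ⟨ν, Set.image_mono (by simp) hν, hνμ⟩) hd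
      (hu.multiples_sdiff hk hlt)
    rw [hq.cartanDim_eq_add q ?_ p, ih', cartanDim_wedgeOn e hd, Finset.sum_insert hk, add_comm,
      compl_compl]
    intro p
    rw [cartanDim_wedgeOn e hd, ih']
    -- Homology of the quotient in degree `p + 1` forces `q = |u k| + p + 1`. Homology of the
    -- smaller ideal in degree `p` would then need an earlier generator of degree `|u k| + 1`, but
    -- earlier ones have degree at most `|u k|`.
    by_cases h : ((u k).card : ℤ) = q - (p + 1 : ℕ)
    · right
      refine Finset.sum_eq_zero fun l hl => if_neg fun hl' => ?_
      have := degreeKey_lt_iff.mp ((hlt l).mpr hl)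
      push_cast at h
      lia
    · exact Or.inl (if_neg h)

/-- The Cartan homology of an ideal with linear quotients. -/
theorem HasLinearQuotients.cartanDim_eq (hu : HasLinearQuotients e I u) (p : ℕ) (q : ℤ) :
    cartanDim (wedge e) (fun j => I.restrictScalars K ⊓ homogeneousPart K V j) p q =
      ∑ k, if ((u k).card : ℤ) = q - p then (linSet e u k).card.multichoose p else 0 := by
  rw [← hu.cartanDim_multiples Finset.univ (fun _ _ _ _ => Finset.mem_univ _)]
  congr 1
  funext j
  rw [gradedSpan_eq, Finset.coe_univ, Set.image_univ]
  congr 1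
  ext x
  exact hu.mem_iff

end MonomialHomology
end ExtBetti

/-! ### Cartan homology of graded free modules and homogeneous maps. -/

namespace ExtBetti

open Module

section FreeModules

variable {K V : Type*} [Field K] [AddCommGroup V] [Module K V] {n : ℕ} (e : Basis (Fin n) K V)

section Action

variable (Y : Type*) [AddCommGroup Y] [Module K Y] [Module (ExteriorAlgebra K V) Y]
  [IsScalarTower K (ExteriorAlgebra K V) Y]

/-- The action of a basis vector of `V` on a module over the exterior algebra of `V`. -/
noncomputable def vecAct (s : Fin n) : Y →ₗ[K] Y :=
  Algebra.lsmul K K Y (ExteriorAlgebra.ι K (e s))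

variable {Y}

theorem vecAct_apply (s : Fin n) (y : Y) : vecAct e Y s y = ExteriorAlgebra.ι K (e s) • y := rfl

theorem vecAct_anti (s t : Fin n) (y : Y) :
    vecAct e Y s (vecAct e Y t y) = -vecAct e Y t (vecAct e Y s y) := by
  simp only [vecAct_apply, smul_smul]
  rw [← neg_smul, eq_neg_of_add_eq_zero_left (ExteriorAlgebra.ι_add_mul_swap (e s) (e t))]

theorem vecAct_sq (s : Fin n) (y : Y) : vecAct e Y s (vecAct e Y s y) = 0 := by
  simp only [vecAct_apply, smul_smul, ExteriorAlgebra.ι_sq_zero, zero_smul]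

end Action

variable {m : ℕ}

/-- The homogeneous elements of degree `j` of the graded free module whose basis has the degrees
`deg`. -/
noncomputable def freePart (K V : Type*) [Field K] [AddCommGroup V] [Module K V] {m : ℕ}
    (deg : Fin m → ℤ) (j : ℤ) : Submodule K (Fin m → ExteriorAlgebra K V) :=
  Submodule.pi Set.univ fun b => homogeneousPart K V (j - deg b)

theorem mem_freePart {deg : Fin m → ℤ} {j : ℤ} {x : Fin m → ExteriorAlgebra K V} :
    x ∈ freePart K V deg j ↔ ∀ b, x b ∈ homogeneousPart K V (j - deg b) := by
  simp [freePart, Submodule.mem_pi]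

theorem hasContractions_free (deg : Fin m → ℤ) :
    HasContractions (vecAct e (Fin m → ExteriorAlgebra K V))
      (fun t => (contraction e t).compLeft (Fin m)) Finset.univ (freePart K V deg) where
  anti := vecAct_anti e
  sq := vecAct_sq e
  mem s j x hx := by
    rw [mem_freePart] at hx ⊢
    intro b
    have := wedge_mem_homogeneousPart e (s := s) (hx b)
    rwa [sub_add_eq_add_sub] at this
  eq_zero s hs := absurd (Finset.mem_univ s) hs
  contract s t _ x := by
    funext b
    have := contraction_wedge e s t (x b)
    split_ifs at this ⊢ <;> exact this
  contract_anti s t x := funext fun b => contraction_anti e s t (x b)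
  contract_sq s x := funext fun b => contraction_sq e s (x b)
  contract_mem t _ j x hx := by
    rw [mem_freePart] at hx ⊢
    intro b
    have := contraction_mem_homogeneousPart e (t := t) (hx b)
    rwa [sub_right_comm] at this

theorem exists_algebraMap_eq {x : ExteriorAlgebra K V}
    (h : ∀ t, contraction e t x = 0) : ∃ c : K, algebraMap K (ExteriorAlgebra K V) c = x := by
  have h1 := mem_basisSpan_disjoint e (T := Finset.univ) fun t _ => h t
  have h2 : {μ : Finset (Fin n) | Disjoint μ Finset.univ} = {∅} := by
    ext μ
    simp [Finset.disjoint_iff_inter_eq_empty]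
  rw [h2, basisSpan, Set.image_singleton, Submodule.mem_span_singleton, basis_empty] at h1
  simpa only [Algebra.algebraMap_eq_smul_one] using h1

theorem algebraMap_mem_homogeneousPart_zero (c : K) :
    algebraMap K (ExteriorAlgebra K V) c ∈ homogeneousPart K V 0 := by
  rw [Algebra.algebraMap_eq_smul_one]
  exact Submodule.smul_mem _ _ one_mem_exteriorPower_zero

theorem algebraMap_eq_zero_of_mem (e : Basis (Fin n) K V) {j : ℤ} (hj : j ≠ 0) {c : K}
    (h : algebraMap K (ExteriorAlgebra K V) c ∈ homogeneousPart K V j) : c = 0 := by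
  have h1 := degreeProj_eq_self e h
  rw [degreeProj_eq_zero e hj.symm (algebraMap_mem_homogeneousPart_zero c)] at h1
  exact (ExteriorAlgebra.algebraMap_eq_zero_iff V c).mp h1.symm

/-- An element of `E` killed by all contractions is a scalar, so the primitives of degree `j` are
the scalar combinations of the basis elements of degree `j`. -/
theorem finrank_primitives_free (deg : Fin m → ℤ) (j : ℤ) :
    finrank K (primitives (fun t => (contraction e t).compLeft (Fin m)) Finset.univ
      (freePart K V deg) j) = (Finset.univ.filter fun b => deg b = j).card := by
  have hmem : ∀ x, x ∈ primitives (fun t => (contraction e t).compLeft (Fin m)) Finset.univ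
      (freePart K V deg) j ↔ x ∈ freePart K V deg j ∧ ∀ t b, contraction e t (x b) = 0 := by
    intro x
    simp only [primitives, Submodule.mem_inf, Submodule.mem_iInf, LinearMap.mem_ker, funext_iff,
      Finset.mem_univ, true_implies, LinearMap.compLeft_apply, Function.comp_apply, Pi.zero_apply]
  let φ : primitives (fun t => (contraction e t).compLeft (Fin m)) Finset.univ
      (freePart K V deg) j ≃ₗ[K] ({b // deg b = j} → K) :=
    { toFun := fun x b => ExteriorAlgebra.algebraMapInv (x.1 b)
      map_add' := fun x y => by
        funext b
        simp
      map_smul' := fun c x => by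
        funext b
        simp
      invFun := fun f => ⟨fun b => if h : deg b = j then algebraMap K _ (f ⟨b, h⟩) else 0, by
        rw [hmem, mem_freePart]
        constructor
        · intro b
          split_ifs with h
          · rw [h, sub_self]
            exact algebraMap_mem_homogeneousPart_zero _
          · exact zero_mem _
        · intro t b
          split_ifs with h
          · rw [Algebra.algebraMap_eq_smul_one, map_smul, contraction_one, smul_zero]
          · exact map_zero _⟩
      left_inv := by
        rintro ⟨x, hx⟩
        rw [hmem, mem_freePart] at hx
        ext b
        obtain ⟨c, hc⟩ := exists_algebraMap_eq e fun t => hx.2 t b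
        dsimp only
        split_ifs with h
        · rw [← hc, ExteriorAlgebra.algebraMap_leftInverse]
        · have h1 := hx.1 b
          rw [← hc] at h1 ⊢
          rw [algebraMap_eq_zero_of_mem e (sub_ne_zero.mpr (Ne.symm h)) h1, map_zero]
      right_inv := by
        intro f
        funext b
        simp [b.2, ExteriorAlgebra.algebraMap_leftInverse V (f b)] }
  rw [φ.finrank_eq, Module.finrank_fintype_fun_eq_card, Fintype.card_subtype]

theorem cartanDim_free_zero (deg : Fin m → ℤ) (q : ℤ) :
    cartanDim (vecAct e (Fin m → ExteriorAlgebra K V)) (freePart K V deg) 0 q =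
      (Finset.univ.filter fun b => deg b = q).card := by
  have := finiteDimensional_exteriorAlgebra e
  rw [(hasContractions_free e deg).cartanDim_eq, finrank_primitives_free]
  simp

theorem cartanDim_free_succ (deg : Fin m → ℤ) (p : ℕ) (q : ℤ) :
    cartanDim (vecAct e (Fin m → ExteriorAlgebra K V)) (freePart K V deg) (p + 1) q = 0 := by
  have := finiteDimensional_exteriorAlgebra e
  rw [(hasContractions_free e deg).cartanDim_eq]
  simp

theorem algebraMapInv_eq_zero_of_mem_maxIdeal {x : ExteriorAlgebra K V} (h : x ∈ maxIdeal K V) :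
    ExteriorAlgebra.algebraMapInv x = 0 := by
  have : maxIdeal K V ≤ RingHom.ker (ExteriorAlgebra.algebraMapInv (R := K) (M := V)) := by
    refine Ideal.span_le.mpr ?_
    rintro _ ⟨v, rfl⟩
    simp [ExteriorAlgebra.algebraMapInv, RingHom.mem_ker]
  exact this h

/-- Homogeneous elements with coefficients in the maximal ideal are boundaries in the Cartan
complex of a graded free module. -/
theorem mem_boundaries_of_mem_maxIdeal (deg : Fin m → ℤ) {q : ℤ}
    {f : Sym (Fin n) 0 → Fin m → ExteriorAlgebra K V} (hf : f ∈ chains (Fin n) (freePart K V deg) 0 q)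
    (hf' : ∀ a b, f a b ∈ maxIdeal K V) :
    f ∈ boundaries (vecAct e (Fin m → ExteriorAlgebra K V)) (freePart K V deg) 0 q := by
  -- The reduced representative `g` has scalar entries. Modulo the maximal ideal both `f` and every
  -- boundary vanish, so these scalars are zero.
  obtain ⟨g, -, hg, hfg⟩ :=
    (hasContractions_free e deg).exists_reduced_cycle (p := 0) hf subset_rfl
  suffices g = 0 by rwa [this, sub_zero] at hfg
  funext a b
  obtain ⟨c, hc⟩ := exists_algebraMap_eq e (x := g a b) fun t =>
    congrFun (hg t (Finset.mem_univ t) a).1 b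
  obtain ⟨y, -, hy⟩ := hfg
  have h1 := congrArg ExteriorAlgebra.algebraMapInv (congrFun (congrFun hy a) b)
  rw [cartanD_apply, Finset.sum_apply, map_sum, Pi.sub_apply, Pi.sub_apply, map_sub,
    algebraMapInv_eq_zero_of_mem_maxIdeal (hf' a b), ← hc, ExteriorAlgebra.algebraMap_leftInverse,
    Finset.sum_eq_zero, zero_sub, zero_eq_neg] at h1
  · rw [← hc, h1, map_zero]
    rfl
  · intro s _
    rw [vecAct_apply, Pi.smul_apply, smul_eq_mul, map_mul]
    simp [ExteriorAlgebra.algebraMapInv]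

/-- The projection of a graded free module onto its component of degree `j`. -/
noncomputable def freeProj (deg : Fin m → ℤ) (j : ℤ) :
    (Fin m → ExteriorAlgebra K V) →ₗ[K] (Fin m → ExteriorAlgebra K V) :=
  LinearMap.pi fun b => degreeProj e (j - deg b) ∘ₗ LinearMap.proj b

theorem freeProj_apply (deg : Fin m → ℤ) (j : ℤ) (x : Fin m → ExteriorAlgebra K V) (b : Fin m) :
    freeProj e deg j x b = degreeProj e (j - deg b) (x b) := rfl

theorem freeProj_mem (deg : Fin m → ℤ) (j : ℤ) (x : Fin m → ExteriorAlgebra K V) :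
    freeProj e deg j x ∈ freePart K V deg j :=
  mem_freePart.mpr fun _ => degreeProj_mem e _ _

theorem freeProj_eq_self {deg : Fin m → ℤ} {j : ℤ} {x : Fin m → ExteriorAlgebra K V}
    (h : x ∈ freePart K V deg j) : freeProj e deg j x = x :=
  funext fun b => degreeProj_eq_self e (mem_freePart.mp h b)

theorem linearMap_apply_eq_sum {Y : Type*} [AddCommGroup Y] [Module (ExteriorAlgebra K V) Y]
    (φ : (Fin m → ExteriorAlgebra K V) →ₗ[ExteriorAlgebra K V] Y)
    (x : Fin m → ExteriorAlgebra K V) : φ x = ∑ b, x b • φ (Pi.single b 1) := by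
  conv_lhs => rw [pi_eq_sum_univ' x, map_sum]
  refine Finset.sum_congr rfl fun b _ => ?_
  rw [← map_smul]

theorem map_freeProj {deg : Fin m → ℤ} {m' : ℕ} {deg' : Fin m' → ℤ}
    {φ : (Fin m → ExteriorAlgebra K V) →ₗ[ExteriorAlgebra K V] (Fin m' → ExteriorAlgebra K V)}
    (hφ : ∀ b c, φ (Pi.single b 1) c ∈ homogeneousPart K V (deg b - deg' c)) (j : ℤ)
    (x : Fin m → ExteriorAlgebra K V) :
    φ (freeProj e deg j x) = freeProj e deg' j (φ x) := by
  funext c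
  rw [freeProj_apply, linearMap_apply_eq_sum φ x, linearMap_apply_eq_sum φ (freeProj e deg j x),
    Finset.sum_apply, Finset.sum_apply, map_sum]
  refine Finset.sum_congr rfl fun b _ => ?_
  rw [Pi.smul_apply, Pi.smul_apply, smul_eq_mul, smul_eq_mul, freeProj_apply,
    ← degreeProj_mul e _ (hφ b c), sub_add_sub_cancel]

theorem map_freeProj_ideal {deg : Fin m → ℤ}
    {φ : (Fin m → ExteriorAlgebra K V) →ₗ[ExteriorAlgebra K V] ExteriorAlgebra K V}
    (hφ : ∀ b, φ (Pi.single b 1) ∈ homogeneousPart K V (deg b)) (j : ℤ)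
    (x : Fin m → ExteriorAlgebra K V) :
    φ (freeProj e deg j x) = degreeProj e j (φ x) := by
  rw [linearMap_apply_eq_sum φ x, linearMap_apply_eq_sum φ (freeProj e deg j x), map_sum]
  refine Finset.sum_congr rfl fun b _ => ?_
  rw [smul_eq_mul, smul_eq_mul, freeProj_apply, ← degreeProj_mul e _ (hφ b), sub_add_cancel]

/-- The graded presentation of the image of a homogeneous map from a graded free module. -/
theorem isGradedQuotient_of_linearMap {Y : Type*} [AddCommGroup Y] [Module K Y]
    [Module (ExteriorAlgebra K V) Y] [IsScalarTower K (ExteriorAlgebra K V) Y]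
    {D : ℤ → Submodule K Y} (hD : ∀ s j y, y ∈ D j → vecAct e Y s y ∈ D (j + 1))
    (π : ℤ → Y →ₗ[K] Y) (hπ : ∀ j y, π j y ∈ D j) (hπ' : ∀ j, ∀ y ∈ D j, π j y = y)
    (deg : Fin m → ℤ) (φ : (Fin m → ExteriorAlgebra K V) →ₗ[ExteriorAlgebra K V] Y)
    (hφ : ∀ j x, φ (freeProj e deg j x) = π j (φ x)) :
    IsGradedQuotient (vecAct e (Fin m → ExteriorAlgebra K V)) (vecAct e Y)
      (fun j => (LinearMap.ker φ).restrictScalars K ⊓ freePart K V deg j) (freePart K V deg)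
      (fun j => (LinearMap.range φ).restrictScalars K ⊓ D j) (φ.restrictScalars K) where
  left :=
    { anti := vecAct_anti e
      sq := vecAct_sq e
      mem := fun s j x hx => ⟨Submodule.smul_mem (LinearMap.ker φ) _ hx.1,
        (hasContractions_free e deg).mem s j x hx.2⟩ }
  middle := (hasContractions_free e deg).toIsExteriorAction
  right :=
    { anti := vecAct_anti e
      sq := vecAct_sq e
      mem := fun s j x hx => ⟨Submodule.smul_mem (LinearMap.range φ) _ hx.1, hD s j x hx.2⟩ }
  comm s j x _ := map_smul φ _ x
  ker j := inf_comm _ _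
  map j := by
    apply le_antisymm
    · rintro _ ⟨x, hx, rfl⟩
      refine ⟨⟨x, rfl⟩, ?_⟩
      have := hφ j x
      rw [freeProj_eq_self e hx] at this
      rw [LinearMap.restrictScalars_apply, this]
      exact hπ j _
    · rintro y ⟨⟨x, rfl⟩, hy⟩
      -- An arbitrary preimage may be replaced by its component of degree `j`.
      refine ⟨_, freeProj_mem e deg j x, ?_⟩
      rw [LinearMap.restrictScalars_apply, hφ, hπ' j _ hy]

end FreeModules

/-! ### Betti numbers as Cartan homology, by dimension shifting. -/

namespace GradedFreeResolution

variable {K V : Type*} [Field K] [AddCommGroup V] [Module K V] {n : ℕ} (e : Basis (Fin n) K V)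
  {I : Ideal (ExteriorAlgebra K V)} (F : GradedFreeResolution I)

/-- The homogeneous components of the module of `i`-th syzygies, the image of `d i`. -/
noncomputable def syzygyPart (i : ℕ) (j : ℤ) : Submodule K (Fin (F.rank i) → ExteriorAlgebra K V) :=
  (LinearMap.range (F.d i)).restrictScalars K ⊓ freePart K V (F.deg i) j

theorem isGradedQuotient_aug :
    IsGradedQuotient (vecAct e (Fin (F.rank 0) → ExteriorAlgebra K V)) (wedge e)
      (F.syzygyPart 0) (freePart K V (F.deg 0))
      (fun j => I.restrictScalars K ⊓ homogeneousPart K V j)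
      ((I.subtype ∘ₗ F.aug).restrictScalars K) := by
  have h := isGradedQuotient_of_linearMap e (Y := ExteriorAlgebra K V)
    (D := homogeneousPart K V) (fun s j y hy => wedge_mem_homogeneousPart e hy) (degreeProj e)
    (degreeProj_mem e) (fun j y hy => degreeProj_eq_self e hy) (F.deg 0) (I.subtype ∘ₗ F.aug)
    (map_freeProj_ideal e F.aug_homogeneous)
  have h1 : LinearMap.range (I.subtype ∘ₗ F.aug) = I := by
    rw [LinearMap.range_comp, LinearMap.range_eq_top.mpr F.aug_surjective, Submodule.map_top,
      Submodule.range_subtype]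
  have h2 : LinearMap.ker (I.subtype ∘ₗ F.aug) = LinearMap.range (F.d 0) := by
    rw [LinearMap.ker_comp_of_ker_eq_bot _ I.ker_subtype, LinearMap.exact_iff.mp F.exact_zero]
  rw [h1, h2] at h
  exact h

theorem isGradedQuotient_d (i : ℕ) :
    IsGradedQuotient (vecAct e (Fin (F.rank (i + 1)) → ExteriorAlgebra K V))
      (vecAct e (Fin (F.rank i) → ExteriorAlgebra K V))
      (F.syzygyPart (i + 1)) (freePart K V (F.deg (i + 1))) (F.syzygyPart i)
      ((F.d i).restrictScalars K) := by
  have h := isGradedQuotient_of_linearMap e (D := freePart K V (F.deg i))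
    (hasContractions_free e _).mem (freeProj e (F.deg i)) (freeProj_mem e _)
    (fun j y hy => freeProj_eq_self e hy) (F.deg (i + 1)) (F.d i)
    (map_freeProj e (F.d_homogeneous i))
  rw [LinearMap.exact_iff.mp (F.exact_succ i)] at h
  exact h

variable {F}

/-- The inclusion of the syzygies into the free module is zero on homology: in degree zero since
minimality puts the syzygies into `𝔪 F i`, in positive degree since free modules are acyclic. -/
theorem IsMinimal.cycles_le_boundaries (hF : F.IsMinimal) (i p : ℕ) (q : ℤ) :
    cycles (vecAct e (Fin (F.rank i) → ExteriorAlgebra K V)) (F.syzygyPart i) p q ≤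
      boundaries (vecAct e _) (freePart K V (F.deg i)) p q := by
  have := finiteDimensional_exteriorAlgebra e
  cases p with
  | zero =>
    intro f hf
    refine mem_boundaries_of_mem_maxIdeal e _ (mem_chains.mpr fun a => (mem_chains.mp hf a).2) ?_
    intro a b
    obtain ⟨x, hx⟩ := (mem_chains.mp hf a).1
    rw [← hx]
    exact hF i x b
  | succ p =>
    refine le_trans ?_ (((hasContractions_free e _).cycles_le_boundaries_iff _ _).mpr
      (cartanDim_free_succ e (F.deg i) p q))
    rintro f ⟨hf, hf'⟩
    exact ⟨mem_chains.mpr fun a => (mem_chains.mp hf a).2, hf'⟩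

/-- Each shift trades one homological degree for one step in the resolution. The last `+ 1` appears
because the image of `d i` is covered by `F (i + 1)`. -/
theorem IsMinimal.cartanDim_syzygyPart (hF : F.IsMinimal) (p i : ℕ) (q : ℤ) :
    cartanDim (vecAct e _) (F.syzygyPart i) p q = F.betti (i + p + 1) q := by
  have := finiteDimensional_exteriorAlgebra e
  induction p generalizing i with
  | zero =>
    rw [(F.isGradedQuotient_d e i).cartanDim_zero_eq q (hF.cycles_le_boundaries e _ _ _),
      cartanDim_free_zero]
    rfl
  | succ p ih =>
    rw [(F.isGradedQuotient_d e i).cartanDim_succ_eq p q (cartanDim_free_succ e _ p q)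
      (hF.cycles_le_boundaries e _ _ _), ih, Nat.add_right_comm i 1 p]
    rfl

/-- The graded Betti numbers are the dimensions of the Cartan homology. -/
theorem IsMinimal.betti_eq_cartanDim (hF : F.IsMinimal) (i : ℕ) (q : ℤ) :
    F.betti i q =
      cartanDim (wedge e) (fun j => I.restrictScalars K ⊓ homogeneousPart K V j) i q := by
  have := finiteDimensional_exteriorAlgebra e
  cases i with
  | zero =>
    rw [(F.isGradedQuotient_aug e).cartanDim_zero_eq q (hF.cycles_le_boundaries e _ _ _),
      cartanDim_free_zero]
    rfl
  | succ p =>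
    rw [(F.isGradedQuotient_aug e).cartanDim_succ_eq p q (cartanDim_free_succ e _ p q)
      (hF.cycles_le_boundaries e _ _ _), hF.cartanDim_syzygyPart e, Nat.zero_add]

end GradedFreeResolution
end ExtBetti

/-! ### Existence of minimal graded free resolutions. -/

namespace ExtBetti

open Module

section Existence

variable {K V : Type*} [Field K] [AddCommGroup V] [Module K V] {n : ℕ} (e : Basis (Fin n) K V)

theorem exists_degreeProj_zero_eq {y : ExteriorAlgebra K V} (h : y ∉ maxIdeal K V) :
    ∃ c : K, c ≠ 0 ∧ degreeProj e 0 y = algebraMap K _ c := by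
  have h1 : degreeProj e 0 y ∈ ⋀[K]^0 V := degreeProj_mem e 0 y
  rw [ExteriorAlgebra.exteriorPower, pow_zero, Submodule.mem_one] at h1
  obtain ⟨c, hc⟩ := h1
  refine ⟨c, ?_, hc.symm⟩
  rintro rfl
  rw [map_zero] at hc
  refine h ?_
  have h2 := (basisProj_eq_zero_iff _).mp hc.symm
  have h3 : y ∈ monomialIdeal e (singleton '' (Set.univ : Set (Fin n))) := by
    rw [mem_monomialIdeal_iff]
    refine basisSpan_mono _ ?_ h2
    intro μ hμ
    have hμ' : μ.Nonempty := by
      rw [Finset.nonempty_iff_ne_empty]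
      rintro rfl
      exact hμ (by simp)
    obtain ⟨s, hs⟩ := hμ'
    exact ⟨{s}, ⟨s, trivial, rfl⟩, Finset.singleton_subset_iff.mpr hs⟩
  rw [← span_ι_eq_monomialIdeal] at h3
  refine Ideal.span_mono ?_ h3
  rintro _ ⟨s, -, rfl⟩
  exact ⟨e s, rfl⟩

theorem sum_freeProj {m : ℕ} (deg : Fin m → ℤ) (x : Fin m → ExteriorAlgebra K V) :
    ∑ j ∈ Finset.univ.image (fun a : Finset (Fin n) × Fin m => (a.1.card : ℤ) + deg a.2),
      freeProj e deg j x = x := by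
  funext b
  rw [Finset.sum_apply]
  simp only [freeProj_apply]
  exact sum_degreeProj e (fun μ => Finset.mem_image.mpr ⟨(μ, b), Finset.mem_univ _, rfl⟩) (x b)

/-- A graded submodule of a graded free module has a minimal graded free cover. -/
theorem exists_minimal_cover {m : ℕ} (deg : Fin m → ℤ)
    (N : Submodule (ExteriorAlgebra K V) (Fin m → ExteriorAlgebra K V))
    (hN : ∀ j, ∀ x ∈ N, freeProj e deg j x ∈ N) :
    ∃ (m' : ℕ) (deg' : Fin m' → ℤ)
      (φ : (Fin m' → ExteriorAlgebra K V) →ₗ[ExteriorAlgebra K V] (Fin m → ExteriorAlgebra K V)),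
      (∀ b c, φ (Pi.single b 1) c ∈ homogeneousPart K V (deg' b - deg c)) ∧
      LinearMap.range φ = N ∧ ∀ x ∈ LinearMap.ker φ, ∀ c, x c ∈ maxIdeal K V := by
  classical
  have := finiteDimensional_exteriorAlgebra e
  have hfg : N.FG := Submodule.FG.of_restrictScalars K (IsNoetherian.noetherian _)
  have hspan : Submodule.span (ExteriorAlgebra K V) {x | x ∈ N ∧ ∃ j, x ∈ freePart K V deg j} =
      N := by
    refine le_antisymm (Submodule.span_le.mpr fun x hx => hx.1) fun x hx => ?_
    rw [← sum_freeProj e deg x]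
    exact Submodule.sum_mem _ fun j _ =>
      Submodule.subset_span ⟨hN j x hx, j, freeProj_mem e deg j x⟩
  rw [← hspan, Submodule.fg_span_iff_fg_span_finset_subset] at hfg
  obtain ⟨t₀, ht₀, ht₀'⟩ := hfg
  -- Take a finite homogeneous generating set that is minimal under inclusion; minimality of the
  -- cover will come from irredundancy.
  obtain ⟨t, ht⟩ := exists_minimal_of_wellFoundedLT
    (fun t : Finset (Fin m → ExteriorAlgebra K V) => (∀ x ∈ t, ∃ j, x ∈ freePart K V deg j) ∧
      Submodule.span (ExteriorAlgebra K V) (t : Set (Fin m → ExteriorAlgebra K V)) = N)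
    ⟨t₀, fun x hx => (ht₀ hx).2, ht₀'.symm.trans hspan⟩
  obtain ⟨ht1, ht2⟩ := ht.prop
  choose! D hD using ht1
  let g : Fin t.card → Fin m → ExteriorAlgebra K V := fun b => (t.equivFin.symm b : _)
  have hg : ∀ b, g b ∈ t := fun b => (t.equivFin.symm b).2
  have hrange : Set.range g = t := by
    ext x
    constructor
    · rintro ⟨b, rfl⟩
      exact hg b
    · intro hx
      exact ⟨t.equivFin ⟨x, hx⟩, by simp [g]⟩
  have hinj : Function.Injective g := Subtype.val_injective.comp t.equivFin.symm.injective
  let φ := Fintype.linearCombination (ExteriorAlgebra K V) g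
  have hφ : ∀ b c, φ (Pi.single b 1) c ∈ homogeneousPart K V (D (g b) - deg c) := by
    intro b c
    have : φ (Pi.single b 1) = g b := by
      simp [φ, Fintype.linearCombination_apply_single]
    rw [this]
    exact mem_freePart.mp (hD _ (hg b)) c
  refine ⟨t.card, fun b => D (g b), φ, hφ, ?_, ?_⟩
  · rw [Fintype.range_linearCombination, hrange, ht2]
  · intro x hx c
    by_contra hc
    obtain ⟨a, ha, ha'⟩ := exists_degreeProj_zero_eq e hc
    -- If a coefficient at `c` of a relation has a constant term, then the component of the relation
    -- in the degree of `g c` has a nonzero scalar there, so `g c` is redundant.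
    set y := freeProj e (fun b => D (g b)) (D (g c)) x with hy
    have hyc : y c = algebraMap K _ a := by
      rw [hy, freeProj_apply, sub_self, ha']
    have hφy : φ y = 0 := by
      rw [hy, map_freeProj e hφ, LinearMap.mem_ker.mp hx, map_zero]
    have hsum : a • g c = -∑ b ∈ Finset.univ.erase c, y b • g b := by
      rw [Fintype.linearCombination_apply, ← Finset.add_sum_erase _ _ (Finset.mem_univ c), hyc,
        algebraMap_smul] at hφy
      exact eq_neg_of_add_eq_zero_left hφy
    have hmem : a⁻¹ • a • g c ∈ Submodule.span (ExteriorAlgebra K V)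
        ((t.erase (g c) : Finset _) : Set (Fin m → ExteriorAlgebra K V)) := by
      rw [hsum]
      refine Submodule.smul_of_tower_mem _ _ (neg_mem (Submodule.sum_mem _ fun b hb => ?_))
      refine Submodule.smul_mem _ _ (Submodule.subset_span ?_)
      exact Finset.mem_erase.mpr ⟨fun h => (Finset.mem_erase.mp hb).1 (hinj h), hg b⟩
    rw [inv_smul_smul₀ ha] at hmem
    have hspan' : Submodule.span (ExteriorAlgebra K V)
        ((t.erase (g c) : Finset _) : Set (Fin m → ExteriorAlgebra K V)) = N := by
      rw [← ht2]
      refine le_antisymm (Submodule.span_mono (Finset.erase_subset _ _)) ?_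
      refine Submodule.span_le.mpr fun x hx => ?_
      by_cases hxc : x = g c
      · exact hxc ▸ hmem
      · exact Submodule.subset_span (Finset.mem_erase.mpr ⟨hxc, hx⟩)
    have hle := ht.le_of_le
      ⟨fun x hx => ⟨D x, hD x (Finset.mem_of_mem_erase hx)⟩, hspan'⟩ (Finset.erase_subset _ _)
    exact Finset.notMem_erase (g c) t (hle (hg c))

/-- A graded submodule of a graded free module of finite rank. -/
structure GradedSubmodule where
  /-- the rank of the ambient module -/
  rank : ℕ
  /-- the degrees of the basis elements -/
  deg : Fin rank → ℤ
  /-- the submodule -/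
  carrier : Submodule (ExteriorAlgebra K V) (Fin rank → ExteriorAlgebra K V)
  freeProj_mem : ∀ j, ∀ x ∈ carrier, freeProj e deg j x ∈ carrier

namespace GradedSubmodule

variable {e} (N : GradedSubmodule e)

/-- The rank of a minimal cover. -/
noncomputable def coverRank : ℕ :=
  (exists_minimal_cover e N.deg N.carrier N.freeProj_mem).choose

/-- The degrees of a minimal cover. -/
noncomputable def coverDeg : Fin N.coverRank → ℤ :=
  (exists_minimal_cover e N.deg N.carrier N.freeProj_mem).choose_spec.choose

/-- A minimal cover. -/
noncomputable def cover : (Fin N.coverRank → ExteriorAlgebra K V) →ₗ[ExteriorAlgebra K V]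
    (Fin N.rank → ExteriorAlgebra K V) :=
  (exists_minimal_cover e N.deg N.carrier N.freeProj_mem).choose_spec.choose_spec.choose

theorem cover_homogeneous (b : Fin N.coverRank) (c : Fin N.rank) :
    N.cover (Pi.single b 1) c ∈ homogeneousPart K V (N.coverDeg b - N.deg c) :=
  (exists_minimal_cover e N.deg N.carrier N.freeProj_mem).choose_spec.choose_spec.choose_spec.1 b c

theorem range_cover : LinearMap.range N.cover = N.carrier :=
  (exists_minimal_cover e N.deg N.carrier N.freeProj_mem).choose_spec.choose_spec.choose_spec.2.1

theorem mem_maxIdeal_of_mem_ker {x : Fin N.coverRank → ExteriorAlgebra K V}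
    (hx : x ∈ LinearMap.ker N.cover) (c : Fin N.coverRank) : x c ∈ maxIdeal K V :=
  (exists_minimal_cover e N.deg N.carrier
    N.freeProj_mem).choose_spec.choose_spec.choose_spec.2.2 x hx c

/-- The kernel of a minimal cover. -/
noncomputable def syzygy : GradedSubmodule e where
  rank := N.coverRank
  deg := N.coverDeg
  carrier := LinearMap.ker N.cover
  freeProj_mem j x hx := by
    rw [LinearMap.mem_ker, map_freeProj e N.cover_homogeneous, LinearMap.mem_ker.mp hx, map_zero]

/-- The iterated syzygies. -/
noncomputable def syzygies : ℕ → GradedSubmodule e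
  | 0 => N
  | i + 1 => (syzygies i).syzygy

end GradedSubmodule

/-- A homogeneous ideal has a minimal graded free resolution by modules of finite rank. -/
theorem exists_isMinimal (I : Ideal (ExteriorAlgebra K V))
    (hI : ∀ j, ∀ x ∈ I, degreeProj e j x ∈ I) : ∃ F : GradedFreeResolution I, F.IsMinimal := by
  -- The ideal is regarded as a graded submodule of the free module of rank one generated in degree
  -- zero, so that a single recursion produces both the augmentation and the differentials.
  let N : GradedSubmodule e :=
    { rank := 1
      deg := fun _ => 0
      carrier := Submodule.comap (LinearMap.proj 0) I
      freeProj_mem := fun j x hx => hI (j - 0) (x 0) hx }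
  let aug : (Fin (N.syzygies 0).coverRank → ExteriorAlgebra K V) →ₗ[ExteriorAlgebra K V] I :=
    LinearMap.codRestrict I
      (LinearMap.proj (φ := fun _ : Fin 1 => ExteriorAlgebra K V) 0 ∘ₗ (N.syzygies 0).cover)
      fun x => N.range_cover.le ⟨x, rfl⟩
  let F : GradedFreeResolution I :=
    { rank := fun i => (N.syzygies i).coverRank
      deg := fun i => (N.syzygies i).coverDeg
      d := fun i => (N.syzygies (i + 1)).cover
      aug := aug
      d_homogeneous := fun i => (N.syzygies (i + 1)).cover_homogeneous
      aug_homogeneous := fun b => by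
        have := N.cover_homogeneous b 0
        rwa [show N.deg 0 = 0 from rfl, sub_zero] at this
      aug_surjective := by
        rintro ⟨y, hy⟩
        obtain ⟨x, hx⟩ := N.range_cover.ge (show (fun _ => y) ∈ N.carrier from hy)
        exact ⟨x, Subtype.ext (congrFun hx 0)⟩
      exact_zero := by
        intro x
        have h1 : x ∈ Set.range (N.syzygies 1).cover ↔ N.cover x = 0 :=
          SetLike.ext_iff.mp (N.syzygies 1).range_cover x
        refine Iff.trans ?_ h1.symm
        rw [Subtype.ext_iff]
        constructor
        · intro h
          funext b
          rw [Subsingleton.elim b (0 : Fin 1)]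
          exact h
        · exact fun h => congrFun h (0 : Fin 1)
      exact_succ := fun i x => (SetLike.ext_iff.mp (N.syzygies (i + 2)).range_cover x).symm }
  refine ⟨F, fun i x c => ?_⟩
  exact (N.syzygies i).mem_maxIdeal_of_mem_ker ((N.syzygies (i + 1)).range_cover.le ⟨x, rfl⟩) c

end Existence
end ExtBetti

/-! ### Assembly of the Betti number formulas. -/

namespace ExtBetti

theorem HasLinearQuotients.degreeProj_mem {K V : Type*} [Field K] [AddCommGroup V] [Module K V]
    {n : ℕ} {e : Module.Basis (Fin n) K V} {I : Ideal (ExteriorAlgebra K V)} {r : ℕ}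
    {u : Fin r → Finset (Fin n)} (hu : HasLinearQuotients e I u) (j : ℤ) {x : ExteriorAlgebra K V}
    (hx : x ∈ I) : degreeProj e j x ∈ I := by
  rw [hu.mem_iff] at hx ⊢
  exact basisSpan_mono _ Set.inter_subset_right (basisProj_mem_of_mem _ _ hx)

/-- Positivity matters: for `a = 0` and `i > 0` the left side is `0`, while truncated subtraction
makes the right side `1`. -/
theorem multichoose_eq_choose {a : ℕ} (ha : 0 < a) (i : ℕ) :
    a.multichoose i = (i + a - 1).choose (a - 1) := by
  rw [Nat.multichoose_eq, Nat.add_comm a i, ← Nat.choose_symm (by lia)]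
  congr 1
  lia

end ExtBetti

theorem corollary3p3 {K V : Type*} [Field K] [AddCommGroup V] [Module K V] {n : ℕ}
    (e : Module.Basis (Fin n) K V) (I : Ideal (ExteriorAlgebra K V)) (hI : I ≠ ⊤)
    {r : ℕ} (u : Fin r → Finset (Fin n)) (hu : ExtBetti.HasLinearQuotients e I u) :
    (∃ F : ExtBetti.GradedFreeResolution I, F.IsMinimal) ∧
      ∀ F : ExtBetti.GradedFreeResolution I, F.IsMinimal →
        (∀ (i : ℕ) (j : ℤ), F.betti i (i + j) =
          ∑ k : Fin r with ((u k).card : ℤ) = j,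
            (i + (ExtBetti.linSet e u k).card - 1).choose ((ExtBetti.linSet e u k).card - 1)) ∧
        ∀ i : ℕ, F.totalBetti i =
          ∑ k : Fin r,
            (i + (ExtBetti.linSet e u k).card - 1).choose ((ExtBetti.linSet e u k).card - 1) := by
  refine ⟨ExtBetti.exists_isMinimal e I fun j x hx => hu.degreeProj_mem j hx, fun F hF => ?_⟩
  have hcard : ∀ k, 0 < (ExtBetti.linSet e u k).card := fun k =>
    Finset.card_pos.mpr ((hu.nonempty hI k).mono (ExtBetti.subset_linSet e u k))
  have hbetti : ∀ (i : ℕ) (j : ℤ), F.betti i (i + j) =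
      ∑ k : Fin r with ((u k).card : ℤ) = j,
        (i + (ExtBetti.linSet e u k).card - 1).choose ((ExtBetti.linSet e u k).card - 1) := by
    intro i j
    rw [hF.betti_eq_cartanDim e, hu.cartanDim_eq, add_sub_cancel_left, Finset.sum_filter]
    simp only [ExtBetti.multichoose_eq_choose (hcard _)]
  refine ⟨hbetti, fun i => ?_⟩
  -- Shifting the summation index by `i` makes the graded formula applicable; the sum over degrees
  -- then regroups the generators by degree.
  rw [ExtBetti.GradedFreeResolution.totalBetti,
    ← finsum_comp_equiv (Equiv.addLeft (i : ℤ))]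
  simp only [Equiv.coe_addLeft, hbetti]
  rw [finsum_eq_sum_of_support_subset
    (s := Finset.univ.image fun k => ((u k).card : ℤ))]
  · exact Finset.sum_fiberwise_of_maps_to
      (fun k _ => Finset.mem_image_of_mem _ (Finset.mem_univ k)) _
  · intro j hj
    obtain ⟨k, hk, -⟩ := Finset.exists_ne_zero_of_sum_ne_zero (Function.mem_support.mp hj)
    exact Finset.mem_coe.mpr (Finset.mem_image.mpr ⟨k, Finset.mem_univ k,
      (Finset.mem_filter.mp hk).2⟩)
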